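/- Let $P$ be the pseudoarc, that is, a nondegenerate continuum (a compact connected metric space with more than one point) that is - chainable: for every $\varepsilon>0$ it is covered by finitely many open sets $U_1,\dots,U_m$ of diameter less than $\varepsilon$ such that $U_i\cap U_j\neq\emptyset$ if and only if $|i-j|\le 1$, and - hereditarily indecomposable: no subcontinuum of $P$ (nonempty closed connected subset) is the union of two proper subcontinua of itself. Let $\mathrm{Homeo}(P)$ be the group of all homeomorphisms of $P$ onto itself, with the topology of uniform convergence, and for a set $I$ let $\mathrm{Homeo}(P)$ act on $\mathrm{Homeo}(P)^I$, with the product topology, by the diagonal conjugacy action $$g\cdot (h_i)_{i\in I} = (g h_i g^{-1})_{i\in I}.$$ Then, for every natural number $n\ge 1$, the diagonal conjugacy action of $\mathrm{Homeo}(P)$ on $\mathrm{Homeo}(P)^n$ has a dense orbit. In fact, the diagonal conjugacy action of $\mathrm{Homeo}(P)$ on $\mathrm{Homeo}(P)^{\mathbb N}$ has a dense orbit. -/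

import Mathlib

/-- A subcontinuum of a compact metric space: a nonempty, closed (hence compact), connected
subset. `IsConnected` includes nonemptiness. -/
def IsSubcontinuum {X : Type*} [TopologicalSpace X] (C : Set X) : Prop :=
  IsClosed C ∧ IsConnected C

/-- A continuum `C` (given as a subset of a space) is indecomposable if it is not the union of
two proper subcontinua. -/
def IsIndecomposableSet {X : Type*} [TopologicalSpace X] (C : Set X) : Prop :=
  ¬ ∃ A B : Set X, IsSubcontinuum A ∧ IsSubcontinuum B ∧ A ≠ C ∧ B ≠ C ∧ A ∪ B = C

/-- A space is hereditarily indecomposable if each of its subcontinua is indecomposable. -/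
def HereditarilyIndecomposable (X : Type*) [TopologicalSpace X] : Prop :=
  ∀ C : Set X, IsSubcontinuum C → IsIndecomposableSet C

/-- A finite sequence of open sets `U 0, …, U (n - 1)` is a chain if `U i` meets `U j` exactly
when `|i - j| ≤ 1`; in particular all links are nonempty. -/
def IsOpenChain {X : Type*} [TopologicalSpace X] {n : ℕ} (U : Fin n → Set X) : Prop :=
  (∀ i, IsOpen (U i)) ∧
    ∀ i j : Fin n, (U i ∩ U j).Nonempty ↔ ((i : ℕ) ≤ (j : ℕ) + 1 ∧ (j : ℕ) ≤ (i : ℕ) + 1)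

/-- A metric space (compact, in the use made of this) is chainable if for each `ε > 0` it is
covered by a chain of open sets of diameter less than `ε`. -/
def Chainable (X : Type*) [MetricSpace X] : Prop :=
  ∀ ε : ℝ, 0 < ε → ∃ (n : ℕ) (U : Fin n → Set X),
    IsOpenChain U ∧ (⋃ i, U i) = Set.univ ∧ ∀ i, Metric.diam (U i) < ε

/-- The metric space `P` is a pseudoarc: a continuum (compact connected metric space) with more
than one point that is chainable and hereditarily indecomposable. -/
structure IsPseudoarc (P : Type*) [MetricSpace P] : Prop where
  compact : CompactSpace P
  connected : ConnectedSpace P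
  nontrivial : Nontrivial P
  chainable : Chainable P
  hereditarilyIndecomposable : HereditarilyIndecomposable P

/-- The topology on the homeomorphism group `P ≃ₜ P` of a compact metric space `P`: the
compact-open topology, that is, the topology of uniform convergence. -/
instance homeoTopology (P : Type*) [MetricSpace P] : TopologicalSpace (P ≃ₜ P) :=
  TopologicalSpace.induced (fun h : P ≃ₜ P => (⟨h, h.continuous⟩ : C(P, P))) inferInstance

/-- The orbit of `γ` under the diagonal conjugacy action of the group `G` on `I → G`: the action
of `ConjAct G` on `I → G` is `g • (γ i)_i = (g * γ i * g⁻¹)_i`. -/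
abbrev diagonalConjOrbit {G I : Type*} [Group G] (γ : I → G) : Set (I → G) :=
  MulAction.orbit (ConjAct G) γ

theorem mem_diagonalConjOrbit_iff {G I : Type*} [Group G] (γ δ : I → G) :
    δ ∈ diagonalConjOrbit γ ↔ ∃ g : G, δ = fun i => g * γ i * g⁻¹ := by
  constructor
  · rintro ⟨g, rfl⟩
    exact ⟨ConjAct.ofConjAct g, rfl⟩
  · rintro ⟨g, rfl⟩
    exact ⟨ConjAct.toConjAct g, rfl⟩

/-!
The proof rests on joint approximation (`IsPseudoarc.exists_joint_approximation`): two finite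
families `h` and `k` of homeomorphisms of the pseudoarc `P` are both approximated by conjugates of a
single family `F`. This is topological transitivity of the diagonal conjugacy action, and since
`Homeo(P)` is Polish, the Baire category theorem turns it into a dense orbit.

*Maps onto arcs.* Hereditary indecomposability makes intersecting subcontinua nested, and this
yields the separation theorem of Krasinkiewicz and Minc (`exists_zigzag`): every real function on
`P` lifts approximately over a map which rises, falls and rises again. Cutting a walk on a finite arc at its
maximal drop reduces it to shorter walks, so real functions lift over all walks
(`exists_isArcMap_lift`). Chainability provides maps of `P` onto arcs with arbitrarily small fibres.
Combining the two, any pair of maps `f`, `g` of `P` onto the same arc can be refined back and forth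
by such pairs, and the intersection of the relations `f x ≈ g y` is the graph of a homeomorphism:
`f ≈ g ∘ φ` for some `φ` (`exists_homeomorph_matching`).

*Reduction to finite relations.* Seen through a map `a` of `P` onto a long arc with small fibres,
`h i` becomes a relation `R i` on the integer points of the arc, which has full projections and is
connected under changes of one coordinate by one. Similarly, `k i` becomes a relation `S i` by means
of a map `b`. By lifting and matching, every connected relation with full projections comes from
a homeomorphism. So it is enough to find a finite arc `J`, mapped onto the arcs of `a` and `b`, and
connected relations with full projections on `J` that project into `R i` and `S i` for every `i`.

*The comb.* Let `J` traverse a comb, which has a tooth of the length of the second arc over each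
point of the first. The position of the tooth and the height on it are the two projections. The
relation of all pairs with positions related by `R i` and heights related by `S i` is connected
(`IsFullRel.combRel`): a tooth can be left only at height `0`, but since the two positions
may change one at a time, the second point of the pair can meanwhile rest at any height related
to `0`. No condition linking the relations for different `i` is needed.
-/

open Set Topology Filter Relation

/-! ### Separation in hereditarily indecomposable compacta -/

theorem HereditarilyIndecomposable.subset_or_subset {X : Type*} [TopologicalSpace X]
    (hX : HereditarilyIndecomposable X) {C D : Set X} (hC : IsSubcontinuum C)
    (hD : IsSubcontinuum D) (hne : (C ∩ D).Nonempty) : C ⊆ D ∨ D ⊆ C := by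
  by_contra hcon
  rw [not_or] at hcon
  refine hX (C ∪ D) ⟨hC.1.union hD.1, hC.2.union hne hD.2⟩ ⟨C, D, hC, hD, ?_, ?_, rfl⟩
  · intro h
    exact hcon.2 (h ▸ subset_union_right)
  · intro h
    exact hcon.1 (h ▸ subset_union_left)

/-- `M₀` is a relatively clopen part of the closed set `M`, expressed by means of its complement
in `M`. -/
def IsClopenPart {X : Type*} [TopologicalSpace X] (M M₀ : Set X) : Prop :=
  IsClosed M₀ ∧ ∃ M₁, IsClosed M₁ ∧ M₀ ∪ M₁ = M ∧ Disjoint M₀ M₁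

namespace IsClopenPart

variable {X : Type*} [TopologicalSpace X] {M A B : Set X}

theorem empty (hM : IsClosed M) : IsClopenPart M ∅ :=
  ⟨isClosed_empty, M, hM, by simp, by simp⟩

theorem self (hM : IsClosed M) : IsClopenPart M M :=
  ⟨hM, ∅, isClosed_empty, by simp, by simp⟩

theorem union (hA : IsClopenPart M A) (hB : IsClopenPart M B) : IsClopenPart M (A ∪ B) := by
  obtain ⟨hA, A', hA', rfl, hdA⟩ := hA
  obtain ⟨hB, B', hB', hBM, hdB⟩ := hB
  refine ⟨hA.union hB, A' ∩ B', hA'.inter hB', ?_, ?_⟩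
  · ext x
    have := Set.ext_iff.1 hBM x
    simp only [mem_union, mem_inter_iff] at *
    tauto
  · rw [Set.disjoint_left] at *
    rintro x (hx | hx) ⟨h1, h2⟩
    · exact hdA hx h1
    · exact hdB hx h2

theorem inter (hA : IsClopenPart M A) (hB : IsClopenPart M B) : IsClopenPart M (A ∩ B) := by
  obtain ⟨hA, A', hA', rfl, hdA⟩ := hA
  obtain ⟨hB, B', hB', hBM, hdB⟩ := hB
  refine ⟨hA.inter hB, A' ∪ B', hA'.union hB', ?_, ?_⟩
  · ext x
    have := Set.ext_iff.1 hBM x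
    simp only [mem_union, mem_inter_iff] at *
    tauto
  · rw [Set.disjoint_left] at *
    rintro x ⟨h1, h2⟩ (h | h)
    · exact hdA h1 h
    · exact hdB h2 h

theorem mem_nhdsWithin (hA : IsClopenPart M A) {x : X} (hx : x ∈ A) {B : Set X} (hB : B ⊆ M) :
    A ∈ 𝓝[B] x := by
  obtain ⟨hA, A', hA', rfl, hdA⟩ := hA
  refine mem_nhdsWithin.2 ⟨A'ᶜ, hA'.isOpen_compl, fun h => Set.disjoint_left.1 hdA hx h, ?_⟩
  rintro y ⟨hy, hyB⟩
  exact (hB hyB).resolve_right hy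

end IsClopenPart

/-- In a compact set `M`, the component of `a` is the intersection of the relatively clopen parts
containing `a`; by compactness one of these parts fits into a given neighbourhood. -/
theorem exists_isClopenPart_subset {X : Type*} [TopologicalSpace X] [CompactSpace X] [T2Space X]
    {M U : Set X} (hM : IsClosed M) (hU : IsOpen U) {a : X} (ha : a ∈ M)
    (h : connectedComponentIn M a ⊆ U) : ∃ M₀, IsClopenPart M M₀ ∧ a ∈ M₀ ∧ M₀ ⊆ U := by
  have : CompactSpace M := isCompact_iff_compactSpace.1 hM.isCompact
  rw [connectedComponentIn_eq_image ha, image_subset_iff, connectedComponent_eq_iInter_isClopen] at h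
  have : Nonempty { s : Set M // IsClopen s ∧ (⟨a, ha⟩ : M) ∈ s } := ⟨⟨univ, isClopen_univ, trivial⟩⟩
  obtain ⟨⟨s, hs, has⟩, hsU⟩ := exists_subset_nhds_of_isCompact'
    (V := fun s : { s : Set M // IsClopen s ∧ (⟨a, ha⟩ : M) ∈ s } => (s : Set M))
    (fun s t => ⟨⟨s ∩ t, s.2.1.inter t.2.1, s.2.2, t.2.2⟩, inter_subset_left, inter_subset_right⟩)
    (fun s => s.2.1.1.isCompact) (fun s => s.2.1.1)
    (fun x hx => (hU.preimage continuous_subtype_val).mem_nhds (h hx))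
  refine ⟨(↑) '' s, ⟨hM.isClosedEmbedding_subtypeVal.isClosedMap _ hs.1, (↑) '' sᶜ,
    hM.isClosedEmbedding_subtypeVal.isClosedMap _ hs.compl.1, ?_, ?_⟩, ⟨_, has, rfl⟩, ?_⟩
  · rw [← image_union, union_compl_self, image_univ, Subtype.range_coe]
  · exact (disjoint_image_iff Subtype.val_injective).2 disjoint_compl_right
  · rintro _ ⟨x, hx, rfl⟩
    exact hsU hx

/-- Components of `M` meeting `A` and components of `N` meeting `B` are disjoint, because two
intersecting subcontinua are nested; compactness turns this into a separation by relatively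
clopen parts. -/
theorem HereditarilyIndecomposable.exists_disjoint_isClopenPart {X : Type*} [TopologicalSpace X]
    [CompactSpace X] [T2Space X] (hX : HereditarilyIndecomposable X) {M N A B : Set X}
    (hM : IsClosed M) (hN : IsClosed N) (hA : IsClosed A) (hB : IsClosed B) (hAM : A ⊆ M)
    (hBN : B ⊆ N) (hAN : Disjoint A N) (hBM : Disjoint B M) :
    ∃ M₀ N₀, IsClopenPart M M₀ ∧ IsClopenPart N N₀ ∧ A ⊆ M₀ ∧ B ⊆ N₀ ∧ Disjoint M₀ N₀ := by
  have hsub : ∀ {K : Set X}, IsClosed K → ∀ {x}, x ∈ K →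
      IsSubcontinuum (connectedComponentIn K x) := by
    intro K hK x hx
    refine ⟨?_, isConnected_connectedComponentIn_iff.2 hx⟩
    rw [connectedComponentIn_eq_image hx]
    exact hK.isClosedEmbedding_subtypeVal.isClosedMap _ isClosed_connectedComponent
  have point : ∀ a ∈ A, ∀ b ∈ B, ∃ M₀ N₀, IsClopenPart M M₀ ∧ IsClopenPart N N₀ ∧ a ∈ M₀ ∧
      b ∈ N₀ ∧ Disjoint M₀ N₀ := by
    intro a ha b hb
    have hE := hsub hM (hAM ha)
    have hF := hsub hN (hBN hb)
    have hEF : Disjoint (connectedComponentIn M a) (connectedComponentIn N b) := by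
      by_contra hcon
      rcases hX.subset_or_subset hE hF (not_disjoint_iff_nonempty_inter.1 hcon) with h | h
      · exact Set.disjoint_left.1 hAN ha
          (connectedComponentIn_subset _ _ (h (mem_connectedComponentIn (hAM ha))))
      · exact Set.disjoint_left.1 hBM hb
          (connectedComponentIn_subset _ _ (h (mem_connectedComponentIn (hBN hb))))
    obtain ⟨M₀, hM₀, haM, hMF⟩ := exists_isClopenPart_subset hM hF.1.isOpen_compl (hAM ha)
      (Set.disjoint_left.1 hEF)
    obtain ⟨N₀, hN₀, hbN, hNM⟩ := exists_isClopenPart_subset hN hM₀.1.isOpen_compl (hBN hb)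
      (fun x hx hxM => hMF hxM hx)
    exact ⟨M₀, N₀, hM₀, hN₀, haM, hbN, Set.disjoint_left.2 fun x h1 h2 => hNM h2 h1⟩
  have line : ∀ b ∈ B, ∃ M₀ N₀, IsClopenPart M M₀ ∧ IsClopenPart N N₀ ∧ A ⊆ M₀ ∧
      b ∈ N₀ ∧ Disjoint M₀ N₀ := by
    intro b hb
    refine hA.isCompact.induction_on (p := fun A => ∃ M₀ N₀, IsClopenPart M M₀ ∧
      IsClopenPart N N₀ ∧ A ⊆ M₀ ∧ b ∈ N₀ ∧ Disjoint M₀ N₀) ?_ ?_ ?_ ?_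
    · exact ⟨∅, N, .empty hM, .self hN, subset_rfl, hBN hb, by simp⟩
    · rintro s t hst ⟨M₀, N₀, h1, h2, h3, h4, h5⟩
      exact ⟨M₀, N₀, h1, h2, hst.trans h3, h4, h5⟩
    · rintro s t ⟨M₀, N₀, h1, h2, h3, h4, h5⟩ ⟨M₀', N₀', h1', h2', h3', h4', h5'⟩
      refine ⟨M₀ ∪ M₀', N₀ ∩ N₀', h1.union h1', h2.inter h2', union_subset_union h3 h3',
        ⟨h4, h4'⟩, ?_⟩
      exact Disjoint.union_left (h5.mono_right inter_subset_left)
        (h5'.mono_right inter_subset_right)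
    · intro a ha
      obtain ⟨M₀, N₀, h1, h2, h3, h4, h5⟩ := point a ha b hb
      exact ⟨M₀, h1.mem_nhdsWithin h3 hAM, M₀, N₀, h1, h2, subset_rfl, h4, h5⟩
  refine hB.isCompact.induction_on (p := fun B => ∃ M₀ N₀, IsClopenPart M M₀ ∧
      IsClopenPart N N₀ ∧ A ⊆ M₀ ∧ B ⊆ N₀ ∧ Disjoint M₀ N₀) ?_ ?_ ?_ ?_
  · exact ⟨M, ∅, .self hM, .empty hN, hAM, subset_rfl, by simp⟩
  · rintro s t hst ⟨M₀, N₀, h1, h2, h3, h4, h5⟩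
    exact ⟨M₀, N₀, h1, h2, h3, hst.trans h4, h5⟩
  · rintro s t ⟨M₀, N₀, h1, h2, h3, h4, h5⟩ ⟨M₀', N₀', h1', h2', h3', h4', h5'⟩
    refine ⟨M₀ ∩ M₀', N₀ ∪ N₀', h1.inter h1', h2.union h2', subset_inter h3 h3',
      union_subset_union h4 h4', ?_⟩
    exact Disjoint.union_right (h5.mono_left inter_subset_left)
      (h5'.mono_left inter_subset_right)
  · intro b hb
    obtain ⟨M₀, N₀, h1, h2, h3, h4, h5⟩ := line b hb
    exact ⟨N₀, h2.mem_nhdsWithin h4 hBN, M₀, N₀, h1, h2, h3, subset_rfl, h5⟩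

/-- The lift of a real function `f` over a map which rises to `t`, falls to `s` and rises again:
`Z₀`, `Z₁`, `Z₂` are the parts of `Z` sent to the three branches, and consecutive parts meet only
over the turning value. -/
theorem HereditarilyIndecomposable.exists_zigzag {X : Type*} [TopologicalSpace X]
    [CompactSpace X] [T2Space X] (hX : HereditarilyIndecomposable X) {Z : Set X}
    (hZ : IsClosed Z) {f : X → ℝ} (hf : Continuous f) {u s t v : ℝ} (hus : u < s) (hst : s ≤ t)
    (htv : t < v) : ∃ Z₀ Z₁ Z₂ : Set X, IsClosed Z₀ ∧ IsClosed Z₁ ∧ IsClosed Z₂ ∧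
      Z₀ ∪ Z₁ ∪ Z₂ = Z ∧ Disjoint Z₀ Z₂ ∧ (∀ x ∈ Z₀, f x ≤ t) ∧ (∀ x ∈ Z₂, s ≤ f x) ∧
      (∀ x ∈ Z₁, u ≤ f x ∧ f x ≤ v) ∧ (∀ x ∈ Z₀ ∩ Z₁, f x = t) ∧ (∀ x ∈ Z₁ ∩ Z₂, f x = s) ∧
      (∀ x ∈ Z, f x ≤ u → x ∈ Z₀) ∧ (∀ x ∈ Z, v ≤ f x → x ∈ Z₂) := by
  have hle : ∀ c : ℝ, IsClosed {x | f x ≤ c} := fun c => isClosed_le hf continuous_const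
  have hge : ∀ c : ℝ, IsClosed {x | c ≤ f x} := fun c => isClosed_le continuous_const hf
  obtain ⟨M₀, N₀, ⟨hM₀, M₁, hM₁, hM, hdM⟩, ⟨hN₀, N₁, hN₁, hN, hdN⟩, hA, hB, hd⟩ :=
    hX.exists_disjoint_isClopenPart (hZ.inter (hle t)) (hZ.inter (hge s)) (hZ.inter (hle u))
      (hZ.inter (hge v))
      (fun x hx => ⟨hx.1, (show f x ≤ u from hx.2).trans (hus.le.trans hst)⟩)
      (fun x hx => ⟨hx.1, (hst.trans htv.le).trans (show v ≤ f x from hx.2)⟩)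
      (Set.disjoint_left.2 fun x hx hx' =>
        absurd ((show s ≤ f x from hx'.2).trans hx.2) (not_le.2 hus))
      (Set.disjoint_left.2 fun x hx hx' =>
        absurd ((show v ≤ f x from hx.2).trans hx'.2) (not_le.2 htv))
  have hM' : ∀ x, (x ∈ M₀ ∨ x ∈ M₁) ↔ (x ∈ Z ∧ f x ≤ t) := fun x => Set.ext_iff.1 hM x
  have hN' : ∀ x, (x ∈ N₀ ∨ x ∈ N₁) ↔ (x ∈ Z ∧ s ≤ f x) := fun x => Set.ext_iff.1 hN x
  rw [Set.disjoint_left] at hdM hdN hd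
  refine ⟨M₀, Z ∩ ((M₁ ∪ {x | t ≤ f x}) ∩ (N₁ ∪ {x | f x ≤ s})), N₀, hM₀,
    hZ.inter ((hM₁.union (hge t)).inter (hN₁.union (hle s))), hN₀, ?_, Set.disjoint_left.2 hd,
    fun x hx => ((hM' x).1 (.inl hx)).2, fun x hx => ((hN' x).1 (.inl hx)).2, ?_, ?_, ?_, ?_, ?_⟩
  · ext x
    constructor
    · rintro ((h | h) | h)
      · exact ((hM' x).1 (.inl h)).1
      · exact h.1
      · exact ((hN' x).1 (.inl h)).1
    · intro hx
      by_cases h0 : x ∈ M₀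
      · exact .inl (.inl h0)
      by_cases h2 : x ∈ N₀
      · exact .inr h2
      refine .inl (.inr ⟨hx, ?_, ?_⟩)
      · by_cases h : f x ≤ t
        · exact .inl (((hM' x).2 ⟨hx, h⟩).resolve_left h0)
        · exact .inr (not_le.1 h).le
      · by_cases h : s ≤ f x
        · exact .inl (((hN' x).2 ⟨hx, h⟩).resolve_left h2)
        · exact .inr (not_le.1 h).le
  · rintro x ⟨hx, h1, h2⟩
    constructor
    · by_contra hlt
      have h0 : x ∈ M₀ := hA ⟨hx, (not_le.1 hlt).le⟩
      rcases h1 with h1 | h1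
      · exact hdM h0 h1
      · exact absurd (show t ≤ f x from h1) (by linarith)
    · by_contra hlt
      have h0 : x ∈ N₀ := hB ⟨hx, (not_le.1 hlt).le⟩
      rcases h2 with h2 | h2
      · exact hdN h0 h2
      · exact absurd (show f x ≤ s from h2) (by linarith)
  · rintro x ⟨h0, hx, h1, -⟩
    rcases h1 with h1 | h1
    · exact absurd h1 (hdM h0)
    · exact le_antisymm ((hM' x).1 (.inl h0)).2 h1
  · rintro x ⟨⟨hx, -, h1⟩, h0⟩
    rcases h1 with h1 | h1
    · exact absurd h1 (hdN h0)
    · exact le_antisymm h1 ((hN' x).1 (.inl h0)).2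
  · exact fun x hx h => hA ⟨hx, h⟩
  · exact fun x hx h => hB ⟨hx, h⟩

/-! ### Lifting real functions over walks -/

/-- `F` lifts `f` on `Z`, up to an error `δ`, over the walk `v` restricted to the indices from
`a` to `b`; near the ends `v a` and `v b` the lift is required to be at the ends `a` and `b`. -/
structure IsWalkLift {X : Type*} [TopologicalSpace X] (Z : Set X) (f : X → ℝ) (v : ℕ → ℝ)
    (a b : ℕ) (δ η : ℝ) (F : X → ℝ) : Prop where
  continuousOn : ContinuousOn F Z
  mem_Icc : ∀ x ∈ Z, F x ∈ Icc (a : ℝ) b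
  eq_left : ∀ x ∈ Z, f x ≤ v a + η → F x = a
  eq_right : ∀ x ∈ Z, v b - η ≤ f x → F x = b
  approx : ∀ x ∈ Z, ∀ j, a ≤ j → j ≤ b → |F x - j| < 1 → |f x - v j| ≤ δ

/-- Two-set gluing of functions continuous on closed sets. -/
theorem exists_continuousOn_glue {X : Type*} [TopologicalSpace X] {A B : Set X} {F G : X → ℝ}
    (hA : IsClosed A) (hB : IsClosed B) (hF : ContinuousOn F A) (hG : ContinuousOn G B)
    (hFG : ∀ x ∈ A ∩ B, F x = G x) :
    ∃ H : X → ℝ, ContinuousOn H (A ∪ B) ∧ EqOn H F A ∧ EqOn H G B := by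
  classical
  have h1 : EqOn (A.piecewise F G) F A := piecewise_eqOn _ _ _
  have h2 : EqOn (A.piecewise F G) G B := by
    intro x hx
    by_cases hxA : x ∈ A
    · rw [piecewise_eq_of_mem _ _ _ hxA, hFG x ⟨hxA, hx⟩]
    · rw [piecewise_eq_of_notMem _ _ _ hxA]
  exact ⟨A.piecewise F G, (hF.congr h1).union_of_isClosed (hG.congr h2) hA hB, h1, h2⟩

theorem IsWalkLift.glue {X : Type*} [TopologicalSpace X] {A B : Set X} {f : X → ℝ} {v : ℕ → ℝ}
    {a i b : ℕ} {δ η : ℝ} {F G H : X → ℝ} (hai : a ≤ i) (hib : i ≤ b)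
    (hF : IsWalkLift A f v a i δ η F)
    (hG : IsWalkLift B f v i b δ η G) (hH : ContinuousOn H (A ∪ B)) (hHF : EqOn H F A)
    (hHG : EqOn H G B) {η' : ℝ} (hη : η' ≤ η)
    (hl : ∀ x ∈ A ∪ B, f x ≤ v a + η' → x ∈ A)
    (hr : ∀ x ∈ A ∪ B, v b - η' ≤ f x → x ∈ B) : IsWalkLift (A ∪ B) f v a b δ η' H := by
  have hai' : (a : ℝ) ≤ i := by exact_mod_cast hai
  have hib' : (i : ℝ) ≤ b := by exact_mod_cast hib
  refine ⟨hH, ?_, ?_, ?_, ?_⟩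
  · rintro x (hx | hx)
    · rw [hHF hx]
      exact ⟨(hF.mem_Icc x hx).1, (hF.mem_Icc x hx).2.trans hib'⟩
    · rw [hHG hx]
      exact ⟨hai'.trans (hG.mem_Icc x hx).1, (hG.mem_Icc x hx).2⟩
  · intro x hx h
    rw [hHF (hl x hx h)]
    exact hF.eq_left x (hl x hx h) (by linarith)
  · intro x hx h
    rw [hHG (hr x hx h)]
    exact hG.eq_right x (hr x hx h) (by linarith)
  · rintro x (hx | hx) j haj hjb hj
    · rw [hHF hx] at hj
      refine hF.approx x hx j haj ?_ hj
      have h1 := (hF.mem_Icc x hx).2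
      have h2 := (abs_lt.1 hj).1
      have : (j : ℝ) < i + 1 := by linarith
      exact Nat.lt_succ_iff.1 (by exact_mod_cast this)
    · rw [hHG hx] at hj
      refine hG.approx x hx j ?_ hjb hj
      have h1 := (hG.mem_Icc x hx).1
      have h2 := (abs_lt.1 hj).2
      have : (i : ℝ) < j + 1 := by linarith
      exact Nat.lt_succ_iff.1 (by exact_mod_cast this)

/-- A lift of `-f` over `-v`, read as a lift of `f` over a walk from its maximum to its minimum. -/
theorem IsWalkLift.neg {X : Type*} [TopologicalSpace X] {A : Set X} {f : X → ℝ} {v : ℕ → ℝ}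
    {a b : ℕ} {δ η : ℝ} {F : X → ℝ} (hF : IsWalkLift A (fun x => -f x) (fun j => -v j) a b δ η F)
    {x : X} (hx : x ∈ A) : (v a - η ≤ f x → F x = a) ∧ (f x ≤ v b + η → F x = b) ∧
      ∀ j, a ≤ j → j ≤ b → |F x - j| < 1 → |f x - v j| ≤ δ := by
  refine ⟨fun h => hF.eq_left x hx (by linarith), fun h => hF.eq_right x hx (by linarith), ?_⟩
  intro j h1 h2 h3
  have := hF.approx x hx j h1 h2 h3
  rwa [neg_sub_neg, abs_sub_comm] at this

/-- If the walk stays within `δ`, any Urysohn function of the two ends is a lift. -/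
theorem exists_isWalkLift_of_le {X : Type*} [TopologicalSpace X] {Z : Set X} {f : X → ℝ}
    (hf : Continuous f) {v : ℕ → ℝ} {a b : ℕ} {δ η : ℝ} (hab : a < b) (hη : 2 * η < v b - v a)
    (hδ : v b - v a ≤ δ) (hv : ∀ j, a ≤ j → j ≤ b → v a ≤ v j ∧ v j ≤ v b)
    (hZ : ∀ x ∈ Z, v a ≤ f x ∧ f x ≤ v b) : ∃ F, IsWalkLift Z f v a b δ η F := by
  have hab' : (a : ℝ) < b := by exact_mod_cast hab
  have hpos : 0 < v b - v a - 2 * η := by linarith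
  refine ⟨fun x => a + (b - a) * max 0 (min 1 ((f x - v a - η) / (v b - v a - 2 * η))),
    ?_, ?_, ?_, ?_, ?_⟩
  · have : Continuous fun x => (a : ℝ) +
        (b - a) * max 0 (min 1 ((f x - v a - η) / (v b - v a - 2 * η))) := by fun_prop
    exact this.continuousOn
  · intro x _
    have h0 : 0 ≤ max 0 (min 1 ((f x - v a - η) / (v b - v a - 2 * η))) := le_max_left _ _
    have h1 : max 0 (min 1 ((f x - v a - η) / (v b - v a - 2 * η))) ≤ 1 :=
      max_le zero_le_one (min_le_left _ _)
    constructor <;> nlinarith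
  · intro x _ h
    have : (f x - v a - η) / (v b - v a - 2 * η) ≤ 0 :=
      div_nonpos_of_nonpos_of_nonneg (by linarith) hpos.le
    rw [max_eq_left ((min_le_right _ _).trans this)]
    ring
  · intro x _ h
    have : 1 ≤ (f x - v a - η) / (v b - v a - 2 * η) := by
      rw [le_div_iff₀ hpos]
      linarith
    rw [min_eq_left this, max_eq_right zero_le_one]
    ring
  · intro x hx j h1 h2 _
    obtain ⟨h3, h4⟩ := hZ x hx
    obtain ⟨h5, h6⟩ := hv j h1 h2
    rw [abs_le]
    constructor <;> linarith

/-- **Lifting over a walk.** In a hereditarily indecomposable compactum, a real function lifts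
over every walk from its minimal to its maximal value. The walk is cut at a pair of indices where
its drop is maximal; `exists_zigzag` cuts `Z` accordingly, and the three shorter walks again run
between their extreme values. The number `G` bounds the gaps between values of the walk; it leaves
room for increasing `η` along the induction. -/
theorem HereditarilyIndecomposable.exists_isWalkLift {X : Type*} [TopologicalSpace X]
    [CompactSpace X] [T2Space X] (hX : HereditarilyIndecomposable X) {G δ : ℝ} (n : ℕ) :
    ∀ (a b : ℕ) (v : ℕ → ℝ) (f : X → ℝ) (Z : Set X) (η : ℝ), b ≤ a + n → Continuous f →
      IsClosed Z → 0 < η → 2 * η < G → a < b →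
      (∀ i j, a ≤ i → i ≤ b → a ≤ j → j ≤ b → v i < v j → v i + G ≤ v j) →
      (∀ j, a ≤ j → j < b → |v (j + 1) - v j| ≤ δ) →
      (∀ j, a ≤ j → j ≤ b → v a ≤ v j ∧ v j ≤ v b) → v a < v b →
      (∀ x ∈ Z, v a ≤ f x ∧ f x ≤ v b) → ∃ F, IsWalkLift Z f v a b δ η F := by
  induction n with
  | zero => intro a b v f Z η h1 _ _ _ _ h2; omega
  | succ n ih =>
  intro a b v f Z η hn hf hZ hη hηG hab hG hstep hv hvab hfZ
  have hGab := hG a b le_rfl hab.le hab.le le_rfl hvab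
  by_cases hδ : v b - v a ≤ δ
  · exact exists_isWalkLift_of_le hf hab (by linarith) hδ hv hfZ
  by_cases hmono : ∀ i j, a ≤ i → i ≤ j → j ≤ b → v i ≤ v j
  · -- A monotone walk can be cut at any intermediate value.
    obtain ⟨i, hai, hib, hvai, hvib⟩ : ∃ i, a < i ∧ i < b ∧ v a < v i ∧ v i < v b := by
      by_contra hcon
      push Not at hcon
      have : ∀ k, a ≤ k → k < b → v k = v a := by
        intro k hak
        induction k, hak using Nat.le_induction with
        | base => intro _; rfl
        | succ k hak ihk =>
          intro hkb
          have h1 := ihk (by omega)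
          by_contra hne
          have h2 : v a < v (k + 1) := lt_of_le_of_ne (hv _ (by omega) hkb.le).1 (Ne.symm hne)
          have h3 := hcon (k + 1) (by omega) hkb h2
          have h4 := abs_le.1 (hstep k hak (by omega))
          linarith
      have h1 := this (b - 1) (by omega) (by omega)
      have h2 := abs_le.1 (hstep (b - 1) (by omega) (by omega))
      rw [Nat.sub_add_cancel (by omega)] at h2
      linarith
    have hGai := hG a i le_rfl hab.le hai.le hib.le hvai
    have hGib := hG i b hai.le hib.le hab.le le_rfl hvib
    have hc0 : IsClosed (Z ∩ {x | f x ≤ v i}) := hZ.inter (isClosed_le hf continuous_const)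
    have hc1 : IsClosed (Z ∩ {x | v i ≤ f x}) := hZ.inter (isClosed_le continuous_const hf)
    obtain ⟨F, hF⟩ := ih a i v f (Z ∩ {x | f x ≤ v i}) η (by omega) hf hc0 hη hηG hai
      (fun j k h1 h2 h3 h4 => hG j k h1 (by omega) h3 (by omega))
      (fun j h1 h2 => hstep j h1 (by omega))
      (fun j h1 h2 => ⟨hmono _ _ le_rfl h1 (by omega), hmono _ _ h1 h2 hib.le⟩) hvai
      (fun x hx => ⟨(hfZ x hx.1).1, hx.2⟩)
    obtain ⟨F', hF'⟩ := ih i b v f (Z ∩ {x | v i ≤ f x}) η (by omega) hf hc1 hη hηG hib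
      (fun j k h1 h2 h3 h4 => hG j k (by omega) h2 (by omega) h4)
      (fun j h1 h2 => hstep j (by omega) h2)
      (fun j h1 h2 => ⟨hmono _ _ hai.le h1 h2, hmono _ _ (by omega) h2 le_rfl⟩) hvib
      (fun x hx => ⟨hx.2, (hfZ x hx.1).2⟩)
    obtain ⟨H, hH, hHF, hHF'⟩ := exists_continuousOn_glue hc0 hc1 hF.continuousOn hF'.continuousOn
      (by
        rintro x ⟨h0, h1⟩
        have e0 : f x ≤ v i := h0.2
        have e1 : v i ≤ f x := h1.2
        rw [hF.eq_right x h0 (by linarith), hF'.eq_left x h1 (by linarith)])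
    have hU : Z ∩ {x | f x ≤ v i} ∪ Z ∩ {x | v i ≤ f x} = Z := by
      ext x
      have := le_total (f x) (v i)
      simp only [mem_union, mem_inter_iff, mem_ofPred_eq]
      tauto
    have := hF.glue hai.le hib.le hF' hH hHF hHF' le_rfl
      (fun x hx h => ⟨(hU ▸ hx : x ∈ Z), show f x ≤ v i by linarith⟩)
      (fun x hx h => ⟨(hU ▸ hx : x ∈ Z), show v i ≤ f x by linarith⟩)
    rw [hU] at this
    exact ⟨H, this⟩
  · push Not at hmono
    obtain ⟨i₀, j₀, hai₀, hij₀, hjb₀, hdrop₀⟩ := hmono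
    obtain ⟨⟨i, j⟩, hmem, hmax⟩ := Finset.exists_max_image
      ((Finset.Icc a b ×ˢ Finset.Icc a b).filter fun p => p.1 ≤ p.2) (fun p => v p.1 - v p.2)
      ⟨(i₀, j₀), by simp only [Finset.mem_filter, Finset.mem_product, Finset.mem_Icc]; omega⟩
    simp only [Finset.mem_filter, Finset.mem_product, Finset.mem_Icc, Prod.forall] at hmem hmax
    obtain ⟨⟨⟨hai, -⟩, -, hjb⟩, hij⟩ := hmem
    have hmax' : ∀ k l, a ≤ k → k ≤ l → l ≤ b → v k - v l ≤ v i - v j := fun k l h1 h2 h3 =>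
      hmax k l ⟨⟨⟨h1, by omega⟩, by omega, h3⟩, h2⟩
    have hdrop : v j < v i := by
      have := hmax' i₀ j₀ hai₀ hij₀ hjb₀
      linarith
    have hvi := hv i hai (by omega)
    have hvj := hv j (by omega) hjb
    have hai' : a < i := lt_of_le_of_ne hai (by rintro rfl; linarith)
    have hjb' : j < b := lt_of_le_of_ne hjb (by rintro rfl; linarith)
    have hij' : i < j := lt_of_le_of_ne hij (by rintro rfl; linarith)
    have hGij := hG j i (by omega) hjb hai (by omega) hdrop
    obtain ⟨η', hηη', hη'G⟩ : ∃ η', η < η' ∧ 2 * η' < G :=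
      ⟨(η + G / 2) / 2, by linarith, by linarith⟩
    obtain ⟨Z₀, Z₁, Z₂, hZ₀, hZ₁, hZ₂, rfl, hd, h₀, h₂, h₁, h₀₁, h₁₂, hl, hr⟩ :=
      hX.exists_zigzag hZ hf (u := v j + η) (s := v j + η') (t := v i - η') (v := v i - η)
        (by linarith) (by linarith) (by linarith)
    obtain ⟨F₀, hF₀⟩ := ih a i v f Z₀ η' (by omega) hf hZ₀ (by linarith) hη'G hai'
      (fun j k h1 h2 h3 h4 => hG j k h1 (by omega) h3 (by omega))
      (fun j h1 h2 => hstep j h1 (by omega))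
      (fun k h1 h2 => ⟨(hv k h1 (by omega)).1, by linarith [hmax' k j h1 (by omega) hjb]⟩)
      (by linarith) (fun x hx => ⟨(hfZ x (.inl (.inl hx))).1, by linarith [h₀ x hx]⟩)
    obtain ⟨F₁, hF₁⟩ := ih i j (fun k => -v k) (fun x => -f x) Z₁ η' (by omega) hf.neg hZ₁
      (by linarith) hη'G hij'
      (fun k l h1 h2 h3 h4 h => by
        have := hG l k (by omega) (by omega) (by omega) (by omega) (by linarith)
        linarith)
      (fun k h1 h2 => by
        rw [neg_sub_neg, abs_sub_comm]
        exact hstep k (by omega) (by omega))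
      (fun k h1 h2 => ⟨by linarith [hmax' k j (by omega) (by omega) hjb],
        by linarith [hmax' i k hai h1 (by omega)]⟩)
      (by linarith) (fun x hx => ⟨by linarith [h₁ x hx], by linarith [h₁ x hx]⟩)
    obtain ⟨F₂, hF₂⟩ := ih j b v f Z₂ η' (by omega) hf hZ₂ (by linarith) hη'G hjb'
      (fun j k h1 h2 h3 h4 => hG j k (by omega) h2 (by omega) h4)
      (fun j h1 h2 => hstep j (by omega) h2)
      (fun k h1 h2 => ⟨by linarith [hmax' i k hai (by omega) h2], (hv k (by omega) h2).2⟩)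
      (by linarith) (fun x hx => ⟨by linarith [h₂ x hx], (hfZ x (.inr hx)).2⟩)
    -- The middle part belongs to the reversed walk, so it is glued by hand to the first part.
    obtain ⟨H₁, hH₁, hH₁₀, hH₁₁⟩ := exists_continuousOn_glue hZ₀ hZ₁ hF₀.continuousOn
      hF₁.continuousOn (by
        intro x hx
        have := h₀₁ x hx
        rw [hF₀.eq_right x hx.1 (by linarith), (hF₁.neg hx.2).1 (by linarith)])
    obtain ⟨H, hH, hHH₁, hHF₂⟩ := exists_continuousOn_glue (hZ₀.union hZ₁) hZ₂ hH₁
      hF₂.continuousOn (by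
        rintro x ⟨hx | hx, hx2⟩
        · exact absurd hx2 (Set.disjoint_left.1 hd hx)
        · have := h₁₂ x ⟨hx, hx2⟩
          rw [hH₁₁ hx, hF₂.eq_left x hx2 (by linarith), (hF₁.neg hx).2.1 (by linarith)])
    have e0 : EqOn H F₀ Z₀ := fun x hx => (hHH₁ (.inl hx)).trans (hH₁₀ hx)
    have e1 : EqOn H F₁ Z₁ := fun x hx => (hHH₁ (.inr hx)).trans (hH₁₁ hx)
    have hai'' : (a : ℝ) ≤ i := by exact_mod_cast hai
    have hij'' : (i : ℝ) ≤ j := by exact_mod_cast hij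
    have hjb'' : (j : ℝ) ≤ b := by exact_mod_cast hjb
    refine ⟨H, hH, ?_, ?_, ?_, ?_⟩
    · rintro x ((hx | hx) | hx)
      · rw [e0 hx]
        exact ⟨(hF₀.mem_Icc x hx).1, by linarith [(hF₀.mem_Icc x hx).2]⟩
      · rw [e1 hx]
        exact ⟨by linarith [(hF₁.mem_Icc x hx).1], by linarith [(hF₁.mem_Icc x hx).2]⟩
      · rw [hHF₂ hx]
        exact ⟨by linarith [(hF₂.mem_Icc x hx).1], (hF₂.mem_Icc x hx).2⟩
    · intro x hx h
      have h0 := hl x hx (by linarith)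
      rw [e0 h0]
      exact hF₀.eq_left x h0 (by linarith)
    · intro x hx h
      have h0 := hr x hx (by linarith)
      rw [hHF₂ h0]
      exact hF₂.eq_right x h0 (by linarith)
    · have key : ∀ {F : X → ℝ} {x : X} {c d k : ℕ}, F x ∈ Icc (c : ℝ) d → |F x - k| < 1 →
          c ≤ k ∧ k ≤ d := by
        intro F x c d k hF hk
        have h1 : (c : ℝ) < k + 1 := by linarith [hF.1, (abs_lt.1 hk).2]
        have h2 : (k : ℝ) < d + 1 := by linarith [hF.2, (abs_lt.1 hk).1]
        exact ⟨Nat.lt_succ_iff.1 (by exact_mod_cast h1), Nat.lt_succ_iff.1 (by exact_mod_cast h2)⟩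
      rintro x ((hx | hx) | hx) k hak hkb hk
      · rw [e0 hx] at hk
        exact hF₀.approx x hx k hak (key (hF₀.mem_Icc x hx) hk).2 hk
      · rw [e1 hx] at hk
        obtain ⟨h1, h2⟩ := key (hF₁.mem_Icc x hx) hk
        exact (hF₁.neg hx).2.2 k h1 h2 hk
      · rw [hHF₂ hx] at hk
        exact hF₂.approx x hx k (key (hF₂.mem_Icc x hx) hk).1 hkb hk

/-- `f` is a continuous map onto the arc `[0, N]`. -/
structure IsArcMap {X : Type*} [TopologicalSpace X] (f : X → ℝ) (N : ℕ) : Prop where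
  continuous : Continuous f
  range_eq : range f = Icc 0 (N : ℝ)

theorem IsArcMap.mem_Icc {X : Type*} [TopologicalSpace X] {f : X → ℝ} {N : ℕ}
    (hf : IsArcMap f N) (x : X) : f x ∈ Icc 0 (N : ℝ) := hf.range_eq ▸ mem_range_self x

theorem IsArcMap.exists_eq {X : Type*} [TopologicalSpace X] {f : X → ℝ} {N : ℕ}
    (hf : IsArcMap f N) {t : ℝ} (h0 : 0 ≤ t) (h1 : t ≤ N) : ∃ x, f x = t := by
  have : t ∈ range f := hf.range_eq ▸ ⟨h0, h1⟩
  exact this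

theorem exists_nat_abs_sub_le {N : ℕ} {t : ℝ} (ht : t ∈ Icc 0 (N : ℝ)) :
    ∃ k : ℕ, k ≤ N ∧ |t - k| ≤ 1 / 2 := by
  have h1 := Nat.floor_le (show 0 ≤ t + 1 / 2 by linarith [ht.1])
  have h2 := Nat.lt_floor_add_one (t + 1 / 2)
  refine ⟨⌊t + 1 / 2⌋₊, ?_, abs_le.2 ⟨by linarith, by linarith⟩⟩
  have : (⌊t + 1 / 2⌋₊ : ℝ) < N + 1 := by linarith [ht.2]
  exact Nat.lt_succ_iff.1 (by exact_mod_cast this)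

theorem IsArcMap.exists_nat {X : Type*} [TopologicalSpace X] {f : X → ℝ} {N : ℕ}
    (hf : IsArcMap f N) (x : X) : ∃ k : ℕ, k ≤ N ∧ |f x - k| ≤ 1 / 2 :=
  exists_nat_abs_sub_le (hf.mem_Icc x)

/-- The gaps between finitely many reals are bounded below. -/
theorem exists_gap (w : ℕ → ℝ) (R : ℕ) :
    ∃ G : ℝ, 0 < G ∧ ∀ i j, i ≤ R → j ≤ R → w i < w j → w i + G ≤ w j := by
  have h : ∀ᶠ G in 𝓝[>] (0 : ℝ), ∀ p ∈ Finset.range (R + 1) ×ˢ Finset.range (R + 1),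
      w p.1 < w p.2 → w p.1 + G ≤ w p.2 := by
    refine (Filter.eventually_all_finset _).2 fun p _ => ?_
    by_cases hp : w p.1 < w p.2
    · filter_upwards [Ioc_mem_nhdsGT (sub_pos.2 hp)] with G hG _
      linarith [hG.2]
    · exact .of_forall fun G h => absurd h hp
  obtain ⟨G, hG, hG0⟩ := (h.and self_mem_nhdsWithin).exists
  exact ⟨G, hG0, fun i j hi hj => hG (i, j)
    (Finset.mem_product.2 ⟨Finset.mem_range.2 (by omega), Finset.mem_range.2 (by omega)⟩)⟩

/-- Lifting over an arbitrary walk `v`, onto all of its domain. Running from the index `a` of the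
minimum back to `0`, then up to `M` and back to the index `b` of the maximum makes the walk start
and end at its extreme values. -/
theorem HereditarilyIndecomposable.exists_isArcMap_lift {X : Type*} [TopologicalSpace X]
    [CompactSpace X] [T2Space X] [ConnectedSpace X] (hX : HereditarilyIndecomposable X)
    {f : X → ℝ} (hf : Continuous f) {M : ℕ} {v : ℕ → ℝ} {δ : ℝ}
    (hstep : ∀ j < M, |v (j + 1) - v j| ≤ δ) {a b : ℕ} (ha : a ≤ M) (hb : b ≤ M)
    (hv : ∀ j ≤ M, v a ≤ v j ∧ v j ≤ v b) (hab : v a < v b) (hfa : ∃ x, f x ≤ v a)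
    (hfb : ∃ x, v b ≤ f x) (hfr : ∀ x, v a - δ ≤ f x ∧ f x ≤ v b + δ) :
    ∃ F : X → ℝ, IsArcMap F M ∧ ∀ x, ∀ j ≤ M, |F x - j| < 1 → |f x - v j| ≤ 3 * δ := by
  have hM : 0 < M := by
    rcases Nat.eq_zero_or_pos M with rfl | h
    · obtain rfl : a = 0 := by omega
      obtain rfl : b = 0 := by omega
      exact absurd hab (lt_irrefl _)
    · exact h
  have hδ : 0 ≤ δ := (abs_nonneg _).trans (hstep 0 hM)
  set R : ℕ := a + 2 * M - b with hR
  set φ : ℕ → ℕ := fun k => if k ≤ a then a - k else if k ≤ a + M then k - a else 2 * M + a - k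
    with hφ
  have hφM : ∀ k, k ≤ R → φ k ≤ M := by
    intro k hk
    simp only [hφ]
    split_ifs <;> omega
  have hφs : ∀ k, k < R → φ (k + 1) = φ k + 1 ∨ φ k = φ (k + 1) + 1 := by
    intro k hk
    simp only [hφ]
    split_ifs <;> omega
  have hφ0 : φ 0 = a := by simp [hφ]
  have hφR : φ R = b := by
    simp only [hφ]
    split_ifs <;> omega
  obtain ⟨G, hG0, hG⟩ := exists_gap (fun k => v (φ k)) R
  set f' : X → ℝ := fun x => max (v a) (min (v b) (f x)) with hf'
  have hff' : ∀ x, |f x - f' x| ≤ δ := by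
    intro x
    obtain ⟨h1, h2⟩ := hfr x
    simp only [hf', abs_le]
    rcases le_total (v b) (f x) with h | h
    · rw [min_eq_left h, max_eq_right hab.le]
      constructor <;> linarith
    · rw [min_eq_right h]
      rcases le_total (v a) (f x) with h' | h'
      · rw [max_eq_right h']
        constructor <;> linarith
      · rw [max_eq_left h']
        constructor <;> linarith
  obtain ⟨F, hF⟩ := hX.exists_isWalkLift (G := G) (δ := δ) R 0 R (fun k => v (φ k)) f' univ (G / 4)
    (by omega) (by fun_prop) isClosed_univ (by linarith) (by linarith) (by omega)
    (fun i j _ h1 _ h2 => hG i j h1 h2)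
    (fun j _ hj => by
      rcases hφs j hj with h | h
      · have h1 := hφM (j + 1) hj
        rw [h] at h1 ⊢
        exact hstep _ h1
      · have h1 := hφM j hj.le
        rw [h] at h1 ⊢
        rw [abs_sub_comm]
        exact hstep _ h1)
    (fun j _ hj => by
      rw [hφ0, hφR]
      exact hv _ (hφM j hj))
    (by rwa [hφ0, hφR])
    (fun x _ => by
      rw [hφ0, hφR]
      exact ⟨le_max_left _ _, max_le hab.le (min_le_left _ _)⟩)
  have hFc : Continuous F := continuousOn_univ.1 hF.continuousOn
  have hFI : ∀ x, F x ∈ Icc (0 : ℝ) R := fun x => by simpa using hF.mem_Icc x trivial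
  have hFsurj : ∀ t ∈ Icc (0 : ℝ) R, ∃ x, F x = t := by
    obtain ⟨x₀, hx₀⟩ := hfa
    obtain ⟨x₁, hx₁⟩ := hfb
    have e0 : F x₀ = 0 := by
      have h := hF.eq_left x₀ trivial
      rw [hφ0] at h
      simpa using h (by
        have : f' x₀ = v a := max_eq_left ((min_le_right _ _).trans hx₀)
        linarith)
    have e1 : F x₁ = R := hF.eq_right x₁ trivial (by
      rw [hφR]
      have : f' x₁ = v b := by
        simp only [hf']
        rw [min_eq_left hx₁, max_eq_right hab.le]
      linarith)
    intro t ht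
    obtain ⟨x, -, hx⟩ := isPreconnected_univ.intermediate_value (mem_univ x₀) (mem_univ x₁)
      hFc.continuousOn (show t ∈ Icc (F x₀) (F x₁) by rwa [e0, e1])
    exact ⟨x, hx⟩
  have hMb : (b : ℝ) ≤ M := by exact_mod_cast hb
  have hMa : (a : ℝ) ≤ M := by exact_mod_cast ha
  have ha0 : (0 : ℝ) ≤ a := a.cast_nonneg
  have hb0 : (0 : ℝ) ≤ b := b.cast_nonneg
  have hRr : (R : ℝ) = a + 2 * M - b := by
    rw [hR, Nat.cast_sub (by omega)]
    push_cast
    ring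
  -- `Φ` is the piecewise linear extension of `φ`.
  set Φ : ℝ → ℝ := fun t => min |t - a| (2 * M + a - t) with hΦ
  have hΦφ : ∀ k ≤ R, Φ k = φ k := by
    intro k hk
    simp only [hΦ, hφ]
    split_ifs with h1 h2
    · have h1' : (k : ℝ) ≤ a := by exact_mod_cast h1
      rw [Nat.cast_sub h1, abs_of_nonpos (by linarith), min_eq_left (by linarith)]
      ring
    · have h1' : (a : ℝ) ≤ k := by exact_mod_cast (not_le.1 h1).le
      have h2' : (k : ℝ) ≤ a + M := by exact_mod_cast h2
      rw [Nat.cast_sub (not_le.1 h1).le, abs_of_nonneg (by linarith), min_eq_left (by linarith)]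
    · have h2' : (a : ℝ) + M ≤ k := by exact_mod_cast (not_le.1 h2).le
      rw [Nat.cast_sub (by omega), abs_of_nonneg (by linarith), min_eq_right (by linarith)]
      push_cast
      ring
  have hΦL : ∀ s t, |Φ s - Φ t| ≤ |s - t| := by
    intro s t
    refine (abs_min_sub_min_le_max _ _ _ _).trans (max_le ?_ ?_)
    · refine (abs_abs_sub_abs_le_abs_sub _ _).trans (le_of_eq ?_)
      congr 1
      ring
    · rw [abs_sub_comm s t]
      refine le_of_eq ?_
      congr 1
      ring
  refine ⟨fun x => Φ (F x), ⟨by fun_prop, ?_⟩, ?_⟩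
  · ext s
    constructor
    · rintro ⟨x, rfl⟩
      obtain ⟨h0, h1⟩ := hFI x
      rw [hRr] at h1
      refine ⟨le_min (abs_nonneg _) (by linarith), ?_⟩
      rcases le_total (F x) (a + M) with h | h
      · exact (min_le_left _ _).trans (abs_le.2 ⟨by linarith, by linarith⟩)
      · exact (min_le_right _ _).trans (by linarith)
    · rintro ⟨h0, h1⟩
      obtain ⟨x, hx⟩ := hFsurj (a + s) ⟨by linarith, by linarith⟩
      refine ⟨x, ?_⟩
      simp only [hx, hΦ]
      rw [abs_of_nonneg (by linarith), min_eq_left (by linarith)]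
      ring
  · intro x j hj hjx
    obtain ⟨k, hkR, hk⟩ := exists_nat_abs_sub_le (hFI x)
    have h1 := hF.approx x trivial k (Nat.zero_le _) hkR (by linarith)
    have h2 := hΦL (F x) k
    rw [hΦφ k hkR] at h2
    have h3 : |(j : ℝ) - φ k| < 2 := by
      have := abs_lt.1 hjx
      have := abs_le.1 (h2.trans hk)
      exact abs_lt.2 ⟨by linarith, by linarith⟩
    have h4 : |v (φ k) - v j| ≤ δ := by
      have h5 : (j : ℝ) < φ k + 2 := by linarith [(abs_lt.1 h3).2]
      have h6 : (φ k : ℝ) < j + 2 := by linarith [(abs_lt.1 h3).1]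
      have h5' : j < φ k + 2 := by exact_mod_cast h5
      have h6' : φ k < j + 2 := by exact_mod_cast h6
      have h7 := hφM k hkR
      obtain h | h | h : j = φ k ∨ j = φ k + 1 ∨ φ k = j + 1 := by omega
      · rw [h, sub_self, abs_zero]
        exact hδ
      · subst h
        rw [abs_sub_comm]
        exact hstep _ hj
      · rw [h]
        exact hstep _ (by omega)
    have e1 := abs_le.1 (hff' x)
    have e2 := abs_le.1 h1
    have e3 := abs_le.1 h4
    exact abs_le.2 ⟨by linarith, by linarith⟩

/-! ### Maps of chainable continua onto arcs -/

/-- A chainable continuum has maps onto arcs with small fibres. Such a map is a weighted mean of the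
indices of the links of a fine chain, rescaled so that the fibres of arcs of length `C` are small. -/
theorem Chainable.exists_isArcMap {X : Type*} [MetricSpace X] [CompactSpace X] [ConnectedSpace X]
    [Nontrivial X] (hX : Chainable X) {η C : ℝ} (hη : 0 < η) (hC : 0 < C) :
    ∃ (M : ℕ) (g : X → ℝ), 1 ≤ M ∧ IsArcMap g M ∧ ∀ x y, |g x - g y| ≤ C → dist x y < η := by
  obtain ⟨x₀, y₀, hne⟩ := exists_pair_ne X
  set η' := min η (dist x₀ y₀) with hη'
  have hη'0 : 0 < η' := lt_min hη (dist_pos.2 hne)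
  obtain ⟨n, U, hU, hcov, hdiam⟩ := hX (η' / 3) (by linarith)
  obtain ⟨φ, hφ⟩ := PartitionOfUnity.exists_isSubordinate isClosed_univ U hU.1 (by rw [hcov])
  have hsum : ∀ x, ∑ i, φ i x = 1 := fun x => by
    rw [← finsum_eq_sum_of_fintype]
    exact φ.sum_eq_one (mem_univ x)
  have hmem : ∀ {i x}, φ i x ≠ 0 → x ∈ U i := fun {i x} h => hφ i (subset_tsupport _ h)
  have hdist : ∀ {i x y}, x ∈ U i → y ∈ U i → dist x y < η' / 3 := fun {i x y} hx hy =>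
    (Metric.dist_le_diam_of_mem (Metric.isBounded_of_compactSpace) hx hy).trans_lt (hdiam i)
  set g : X → ℝ := fun x => ∑ i, φ i x * (i : ℕ) with hg
  have hgc : Continuous g := by fun_prop
  have hnear : ∀ {i x}, φ i x ≠ 0 → |g x - (i : ℕ)| ≤ 1 := by
    intro i x hi
    have : g x - (i : ℕ) = ∑ j, φ j x * ((j : ℕ) - (i : ℕ) : ℝ) := by
      simp only [hg, mul_sub, Finset.sum_sub_distrib, ← Finset.sum_mul, hsum, one_mul]
    rw [this, ← hsum x]
    refine (Finset.abs_sum_le_sum_abs _ _).trans (Finset.sum_le_sum fun j _ => ?_)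
    rw [abs_mul, abs_of_nonneg (φ.nonneg j x)]
    by_cases hj : φ j x = 0
    · simp [hj]
    · obtain ⟨h1, h2⟩ := (hU.2 i j).1 ⟨x, hmem hi, hmem hj⟩
      have h1' : ((i : ℕ) : ℝ) ≤ (j : ℕ) + 1 := by exact_mod_cast h1
      have h2' : ((j : ℕ) : ℝ) ≤ (i : ℕ) + 1 := by exact_mod_cast h2
      exact mul_le_of_le_one_right (φ.nonneg j x) (abs_le.2 ⟨by linarith, by linarith⟩)
  have hfine : ∀ x y, |g x - g y| ≤ 1 / 2 → dist x y < η' := by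
    intro x y hxy
    obtain ⟨i, hi⟩ : ∃ i, φ i x ≠ 0 := by
      by_contra! h
      simpa [h] using hsum x
    obtain ⟨j, hj⟩ : ∃ j, φ j y ≠ 0 := by
      by_contra! h
      simpa [h] using hsum y
    have h1 := abs_le.1 (hnear hi)
    have h2 := abs_le.1 (hnear hj)
    have h3 := abs_le.1 hxy
    have h4 : ((i : ℕ) : ℝ) < (j : ℕ) + 3 := by linarith
    have h5 : ((j : ℕ) : ℝ) < (i : ℕ) + 3 := by linarith
    have h4' : (i : ℕ) < (j : ℕ) + 3 := by exact_mod_cast h4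
    have h5' : (j : ℕ) < (i : ℕ) + 3 := by exact_mod_cast h5
    have hm : ((i : ℕ) + j) / 2 < n := by
      have := i.2
      have := j.2
      omega
    obtain ⟨z, hz, hz'⟩ := (hU.2 i ⟨_, hm⟩).2 ⟨by simp only; omega, by simp only; omega⟩
    obtain ⟨w, hw, hw'⟩ := (hU.2 ⟨_, hm⟩ j).2 ⟨by simp only; omega, by simp only; omega⟩
    have d1 := hdist (hmem hi) hz
    have d2 := hdist hz' hw
    have d3 := hdist hw' (hmem hj)
    have := dist_triangle4 x z w y
    linarith
  obtain ⟨p, -, hp⟩ := isCompact_univ.exists_isMinOn (univ_nonempty (α := X)) hgc.continuousOn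
  obtain ⟨q, -, hq⟩ := isCompact_univ.exists_isMaxOn (univ_nonempty (α := X)) hgc.continuousOn
  have hp' : ∀ x, g p ≤ g x := fun x => hp (mem_univ x)
  have hq' : ∀ x, g x ≤ g q := fun x => hq (mem_univ x)
  have hpq : 0 < g q - g p := by
    by_contra hcon
    have := hfine x₀ y₀ (abs_le.2
      ⟨by linarith [hp' x₀, hq' y₀], by linarith [hp' y₀, hq' x₀]⟩)
    exact absurd (min_le_right η (dist x₀ y₀)) (not_le.2 this)
  set M := ⌈2 * C * (g q - g p)⌉₊ with hMdef
  have hM : 2 * C * (g q - g p) ≤ M := Nat.le_ceil _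
  have hMpos : 0 < (M : ℝ) := lt_of_lt_of_le (by positivity) hM
  set c := (M : ℝ) / (g q - g p) with hc
  have hcpos : 0 < c := by positivity
  have hcC : 2 * C ≤ c := by rwa [hc, le_div_iff₀ hpq]
  have hcM : c * (g q - g p) = M := by
    rw [hc]
    field_simp
  refine ⟨M, fun x => c * (g x - g p), by exact_mod_cast hMpos, ⟨by fun_prop, ?_⟩, ?_⟩
  · ext t
    constructor
    · rintro ⟨x, rfl⟩
      refine ⟨mul_nonneg hcpos.le (by linarith [hp' x]), ?_⟩
      rw [← hcM]
      exact mul_le_mul_of_nonneg_left (by linarith [hq' x]) hcpos.le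
    · rintro ⟨h0, h1⟩
      obtain ⟨x, -, hx⟩ := isPreconnected_univ.intermediate_value (mem_univ p) (mem_univ q)
        hgc.continuousOn (show t / c + g p ∈ Icc (g p) (g q) from
          ⟨by linarith [div_nonneg h0 hcpos.le], by
            have : t / c ≤ g q - g p := by
              rw [div_le_iff₀ hcpos]
              linarith
            linarith⟩)
      refine ⟨x, ?_⟩
      simp only [hx]
      field_simp
      ring
  · intro x y hxy
    refine (hfine x y ?_).trans_le (min_le_left _ _)
    rw [show c * (g x - g p) - c * (g y - g p) = c * (g x - g y) by ring, abs_mul,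
      abs_of_pos hcpos] at hxy
    by_contra! hcon
    have h1 : c * (1 / 2) < c * |g x - g y| := mul_lt_mul_of_pos_left hcon hcpos
    linarith

/-! ### Matching two maps onto an arc by a homeomorphism -/

/-- A pair of arc maps is refined by a pair whose second map has small fibres: `g` factors
approximately through a fine map `g'`, and `f` is lifted over the walk through which it factors. -/
theorem exists_refinement {X Y : Type*} [MetricSpace X] [CompactSpace X] [ConnectedSpace X]
    [MetricSpace Y] [CompactSpace Y] [ConnectedSpace Y] [Nontrivial Y]
    (hX : HereditarilyIndecomposable X) (hY : Chainable Y) {N : ℕ} (hN : 1 ≤ N) {f : X → ℝ}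
    {g : Y → ℝ} (hf : IsArcMap f N) (hg : IsArcMap g N) {η : ℝ} (hη : 0 < η) :
    ∃ (M : ℕ) (f' : X → ℝ) (g' : Y → ℝ), 1 ≤ M ∧ IsArcMap f' M ∧ IsArcMap g' M ∧
      (∀ x y, |f' x - g' y| ≤ 1 / 4 → |f x - g y| ≤ 1 / 4) ∧
      ∀ y y', |g' y - g' y'| ≤ 1 / 2 → dist y y' < η := by
  obtain ⟨θ, hθ, hgθ⟩ := Metric.uniformContinuous_iff.1
    (CompactSpace.uniformContinuous_of_continuous hg.continuous) (1 / 16) (by norm_num)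
  obtain ⟨M, g', hM, hg', hfine⟩ := hY.exists_isArcMap (lt_min hη hθ) (zero_lt_two (α := ℝ))
  have hgθ' : ∀ y y', |g' y - g' y'| ≤ 2 → |g y - g y'| ≤ 1 / 16 := fun y y' h =>
    (hgθ ((hfine y y' h).trans_le (min_le_right _ _))).le
  have hex : ∀ j : ℕ, ∃ y, j ≤ M → g' y = j := fun j => by
    by_cases hj : j ≤ M
    · obtain ⟨y, hy⟩ := hg'.exists_eq j.cast_nonneg (by exact_mod_cast hj)
      exact ⟨y, fun _ => hy⟩
    · exact ⟨Classical.arbitrary Y, fun h => absurd h hj⟩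
  choose y hy using hex
  have hclose : ∀ z, ∃ j ≤ M, |g z - g (y j)| ≤ 1 / 16 := by
    intro z
    obtain ⟨j, hj, hzj⟩ := hg'.exists_nat z
    exact ⟨j, hj, hgθ' _ _ (by rw [hy j hj]; linarith)⟩
  obtain ⟨a, ha, hmin⟩ := Finset.exists_min_image (Finset.range (M + 1)) (fun j => g (y j)) ⟨0, by simp⟩
  obtain ⟨b, hb, hmax⟩ := Finset.exists_max_image (Finset.range (M + 1)) (fun j => g (y j)) ⟨0, by simp⟩
  have hN' : (1 : ℝ) ≤ N := by exact_mod_cast hN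
  have hva : g (y a) ≤ 1 / 16 := by
    obtain ⟨z, hz⟩ := hg.exists_eq le_rfl (by linarith)
    obtain ⟨j, hj, hzj⟩ := hclose z
    have := hmin j (Finset.mem_range.2 (by omega))
    have := abs_le.1 hzj
    linarith
  have hvb : N - 1 / 16 ≤ g (y b) := by
    obtain ⟨z, hz⟩ := hg.exists_eq (t := N) (by linarith) le_rfl
    obtain ⟨j, hj, hzj⟩ := hclose z
    have := hmax j (Finset.mem_range.2 (by omega))
    have := abs_le.1 hzj
    linarith
  obtain ⟨f', hf', hff'⟩ := hX.exists_isArcMap_lift hf.continuous (M := M) (v := fun j => g (y j))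
    (δ := 1 / 16) (fun j hj => hgθ' _ _ (by
      rw [hy j hj.le, hy (j + 1) hj]
      push_cast
      rw [add_sub_cancel_left, abs_one]
      norm_num)) (a := a) (b := b) (by simpa [Nat.lt_succ_iff] using ha)
    (by simpa [Nat.lt_succ_iff] using hb)
    (fun j hj => ⟨hmin j (Finset.mem_range.2 (by omega)), hmax j (Finset.mem_range.2 (by omega))⟩)
    (by linarith)
    (by
      obtain ⟨x, hx⟩ := hf.exists_eq le_rfl (by linarith)
      exact ⟨x, hx.le.trans (hg.mem_Icc _).1⟩)
    (by
      obtain ⟨x, hx⟩ := hf.exists_eq (t := N) (by linarith) le_rfl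
      exact ⟨x, (hg.mem_Icc _).2.trans hx.ge⟩)
    (fun x => by
      obtain ⟨h1, h2⟩ := hf.mem_Icc x
      constructor <;> linarith)
  refine ⟨M, f', g', hM, hf', hg', ?_, fun z z' h =>
    (hfine z z' (by linarith)).trans_le (min_le_left _ _)⟩
  intro x z hxz
  obtain ⟨j, hj, hxj⟩ := hf'.exists_nat x
  have h1 := abs_le.1 (hff' x j hj (by linarith))
  have h2 : |g z - g (y j)| ≤ 1 / 16 := hgθ' _ _ (by
    rw [hy j hj]
    have := abs_le.1 hxz
    have := abs_le.1 hxj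
    exact abs_le.2 ⟨by linarith, by linarith⟩)
  have h3 := abs_le.1 h2
  exact abs_le.2 ⟨by linarith, by linarith⟩

/-- Refining twice, with the roles of the two spaces exchanged, makes the relation between the
spaces have small fibres on both sides. -/
theorem exists_common_refinement {X Y : Type*} [MetricSpace X] [CompactSpace X]
    [ConnectedSpace X] [Nontrivial X] [MetricSpace Y] [CompactSpace Y] [ConnectedSpace Y]
    [Nontrivial Y] (hX : HereditarilyIndecomposable X) (hX' : Chainable X)
    (hY : HereditarilyIndecomposable Y) (hY' : Chainable Y) {N : ℕ} (hN : 1 ≤ N) {f : X → ℝ}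
    {g : Y → ℝ} (hf : IsArcMap f N) (hg : IsArcMap g N) {η : ℝ} (hη : 0 < η) :
    ∃ (M : ℕ) (f' : X → ℝ) (g' : Y → ℝ), 1 ≤ M ∧ IsArcMap f' M ∧ IsArcMap g' M ∧
      (∀ x y, |f' x - g' y| ≤ 1 / 4 → |f x - g y| ≤ 1 / 4) ∧
      (∀ x y y', |f' x - g' y| ≤ 1 / 4 → |f' x - g' y'| ≤ 1 / 4 → dist y y' < η) ∧
      ∀ x x' y, |f' x - g' y| ≤ 1 / 4 → |f' x' - g' y| ≤ 1 / 4 → dist x x' < η := by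
  obtain ⟨M, f₁, g₁, hM, hf₁, hg₁, hG, hη₁⟩ := exists_refinement hX hY' hN hf hg hη
  obtain ⟨K, g₂, f₂, hK, hg₂, hf₂, hG', hη₂⟩ := exists_refinement hY hX' hM hg₁ hf₁ hη
  have hG₂ : ∀ x y, |f₂ x - g₂ y| ≤ 1 / 4 → |f₁ x - g₁ y| ≤ 1 / 4 := fun x y h => by
    rw [abs_sub_comm] at h ⊢
    exact hG' y x h
  refine ⟨K, f₂, g₂, hK, hf₂, hg₂, fun x y h => hG x y (hG₂ x y h), ?_, ?_⟩
  · intro x y y' h h'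
    have h1 := abs_le.1 (hG₂ _ _ h)
    have h2 := abs_le.1 (hG₂ _ _ h')
    exact hη₁ _ _ (abs_le.2 ⟨by linarith, by linarith⟩)
  · intro x x' y h h'
    have h1 := abs_le.1 h
    have h2 := abs_le.1 h'
    exact hη₂ _ _ (abs_le.2 ⟨by linarith, by linarith⟩)

/-- The intersection of a decreasing sequence of closed relations, full on both sides and with
fibres shrinking to points, is the graph of a homeomorphism. -/
theorem exists_homeomorph_of_relations {X Y : Type*} [MetricSpace X] [CompactSpace X]
    [MetricSpace Y] [CompactSpace Y] (G : ℕ → Set (X × Y)) (hcl : ∀ n, IsClosed (G n))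
    (hanti : ∀ n, G (n + 1) ⊆ G n) (hl : ∀ n x, ∃ y, (x, y) ∈ G n)
    (hr : ∀ n y, ∃ x, (x, y) ∈ G n)
    (hy : ∀ ε > 0, ∃ n, ∀ x y y', (x, y) ∈ G n → (x, y') ∈ G n → dist y y' < ε)
    (hx : ∀ ε > 0, ∃ n, ∀ x x' y, (x, y) ∈ G n → (x', y) ∈ G n → dist x x' < ε) :
    ∃ φ : X ≃ₜ Y, ∀ n x, (x, φ x) ∈ G n := by
  have h1 : ∀ x, ∃ y, ∀ n, (x, y) ∈ G n := fun x => by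
    obtain ⟨y, hy⟩ := IsCompact.nonempty_iInter_of_sequence_nonempty_isCompact_isClosed
      (fun n => {y | (x, y) ∈ G n}) (fun n y hy => hanti n hy) (fun n => hl n x)
      ((hcl 0).preimage (Continuous.prodMk_right x)).isCompact
      (fun n => (hcl n).preimage (Continuous.prodMk_right x))
    exact ⟨y, fun n => mem_iInter.1 hy n⟩
  have h2 : ∀ y, ∃ x, ∀ n, (x, y) ∈ G n := fun y => by
    obtain ⟨x, hx⟩ := IsCompact.nonempty_iInter_of_sequence_nonempty_isCompact_isClosed
      (fun n => {x | (x, y) ∈ G n}) (fun n x hx => hanti n hx) (fun n => hr n y)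
      ((hcl 0).preimage (Continuous.prodMk_left y)).isCompact
      (fun n => (hcl n).preimage (Continuous.prodMk_left y))
    exact ⟨x, fun n => mem_iInter.1 hx n⟩
  choose φ hφ using h1
  choose ψ hψ using h2
  have uy : ∀ {x y y'}, (∀ n, (x, y) ∈ G n) → (∀ n, (x, y') ∈ G n) → y = y' := by
    intro x y y' h h'
    refine dist_le_zero.1 (le_of_forall_pos_lt_add fun ε hε => ?_)
    obtain ⟨n, hn⟩ := hy ε hε
    rw [zero_add]
    exact hn x y y' (h n) (h' n)
  have ux : ∀ {x x' y}, (∀ n, (x, y) ∈ G n) → (∀ n, (x', y) ∈ G n) → x = x' := by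
    intro x x' y h h'
    refine dist_le_zero.1 (le_of_forall_pos_lt_add fun ε hε => ?_)
    obtain ⟨n, hn⟩ := hx ε hε
    rw [zero_add]
    exact hn x x' y (h n) (h' n)
  let e : X ≃ Y := ⟨φ, ψ, fun x => ux (hψ (φ x)) (hφ x), fun y => uy (hφ (ψ y)) (hψ y)⟩
  have hcont : Continuous e := by
    rw [continuous_iff_isClosed]
    intro K hK
    have : e ⁻¹' K = Prod.fst '' ((⋂ n, G n) ∩ Prod.snd ⁻¹' K) := by
      ext x
      constructor
      · intro h
        exact ⟨(x, φ x), ⟨mem_iInter.2 (hφ x), h⟩, rfl⟩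
      · rintro ⟨⟨x, y⟩, ⟨h, hyK⟩, rfl⟩
        have : φ x = y := uy (hφ x) (mem_iInter.1 h)
        exact (show φ x ∈ K from this ▸ hyK)
    rw [this]
    exact isClosedMap_fst_of_compactSpace _
      ((isClosed_iInter hcl).inter (hK.preimage continuous_snd))
  exact ⟨hcont.homeoOfEquivCompactToT2, fun n x => hφ x n⟩

/-- **Approximate homogeneity.** Two maps onto the same arc differ approximately by a homeomorphism,
namely the limit of the relations given by successive common refinements. -/
theorem exists_homeomorph_matching {X Y : Type*} [MetricSpace X] [CompactSpace X]
    [ConnectedSpace X] [Nontrivial X] [MetricSpace Y] [CompactSpace Y] [ConnectedSpace Y]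
    [Nontrivial Y] (hX : HereditarilyIndecomposable X) (hX' : Chainable X)
    (hY : HereditarilyIndecomposable Y) (hY' : Chainable Y) {N : ℕ} (hN : 1 ≤ N) {f : X → ℝ}
    {g : Y → ℝ} (hf : IsArcMap f N) (hg : IsArcMap g N) :
    ∃ φ : X ≃ₜ Y, ∀ x, |f x - g (φ x)| ≤ 1 / 4 := by
  let S := {s : (X → ℝ) × (Y → ℝ) // ∃ N : ℕ, 1 ≤ N ∧ IsArcMap s.1 N ∧ IsArcMap s.2 N}
  let rel : S → Set (X × Y) := fun s => {p | |s.1.1 p.1 - s.1.2 p.2| ≤ 1 / 4}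
  have hnext : ∀ (n : ℕ) (s : S), ∃ s' : S, rel s' ⊆ rel s ∧
      (∀ x y y', (x, y) ∈ rel s' → (x, y') ∈ rel s' → dist y y' < 1 / ((n : ℝ) + 1)) ∧
      ∀ x x' y, (x, y) ∈ rel s' → (x', y) ∈ rel s' → dist x x' < 1 / ((n : ℝ) + 1) := by
    rintro n ⟨⟨f, g⟩, N, hN, hf, hg⟩
    obtain ⟨M, f', g', hM, hf', hg', h1, h2, h3⟩ := exists_common_refinement hX hX' hY hY' hN hf hg
      (η := 1 / ((n : ℝ) + 1)) (by positivity)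
    exact ⟨⟨(f', g'), M, hM, hf', hg'⟩, fun p hp => h1 p.1 p.2 hp, h2, h3⟩
  choose next hsub hy hx using hnext
  let s : ℕ → S := fun n => Nat.rec ⟨(f, g), N, hN, hf, hg⟩ next n
  have hcl : ∀ s : S, IsClosed (rel s) := by
    rintro ⟨⟨f, g⟩, N, hN, hf, hg⟩
    have h1 := hf.continuous
    have h2 := hg.continuous
    exact isClosed_le (by fun_prop) continuous_const
  have hfull : ∀ s : S, (∀ x, ∃ y, (x, y) ∈ rel s) ∧ ∀ y, ∃ x, (x, y) ∈ rel s := by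
    rintro ⟨⟨f, g⟩, N, hN, hf, hg⟩
    constructor
    · intro x
      obtain ⟨y, hy⟩ := hg.exists_eq (hf.mem_Icc x).1 (hf.mem_Icc x).2
      exact ⟨y, show |f x - g y| ≤ 1 / 4 by
        rw [show g y = f x from hy, sub_self, abs_zero]; norm_num⟩
    · intro y
      obtain ⟨x, hx⟩ := hf.exists_eq (hg.mem_Icc y).1 (hg.mem_Icc y).2
      exact ⟨x, show |f x - g y| ≤ 1 / 4 by
        rw [show f x = g y from hx, sub_self, abs_zero]; norm_num⟩
  obtain ⟨φ, hφ⟩ := exists_homeomorph_of_relations (fun n => rel (s n)) (fun n => hcl _)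
    (fun n => hsub n (s n)) (fun n => (hfull _).1) (fun n => (hfull _).2)
    (fun ε hε => by
      obtain ⟨n, hn⟩ := exists_nat_one_div_lt hε
      exact ⟨n + 1, fun x y y' h h' => (hy n (s n) x y y' h h').trans hn⟩)
    (fun ε hε => by
      obtain ⟨n, hn⟩ := exists_nat_one_div_lt hε
      exact ⟨n + 1, fun x x' y h h' => (hx n (s n) x x' y h h').trans hn⟩)
  exact ⟨φ, hφ 0⟩

/-! ### Joint refinement of relations on finite arcs -/

/-- A step between two pairs of `R` that moves exactly one coordinate, by one. -/
def RookStep (R : Set (ℕ × ℕ)) (p q : ℕ × ℕ) : Prop :=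
  p ∈ R ∧ q ∈ R ∧ ((p.2 = q.2 ∧ (q.1 = p.1 + 1 ∨ p.1 = q.1 + 1)) ∨
    (p.1 = q.1 ∧ (q.2 = p.2 + 1 ∨ p.2 = q.2 + 1)))

/-- A step between two pairs of `T` that moves each coordinate by at most one. -/
def KingStep (T : Set (ℕ × ℕ)) (p q : ℕ × ℕ) : Prop :=
  p ∈ T ∧ q ∈ T ∧ p.1 ≤ q.1 + 1 ∧ q.1 ≤ p.1 + 1 ∧ p.2 ≤ q.2 + 1 ∧ q.2 ≤ p.2 + 1

instance (T : Set (ℕ × ℕ)) : Std.Symm (KingStep T) :=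
  ⟨fun _ _ ⟨h1, h2, h3, h4, h5, h6⟩ => ⟨h2, h1, h4, h3, h6, h5⟩⟩

/-- `R` is a relation on `{0, …, K}` with full projections, connected under steps of type `r`. -/
structure IsFullRel (r : Set (ℕ × ℕ) → ℕ × ℕ → ℕ × ℕ → Prop) (K : ℕ) (R : Set (ℕ × ℕ)) :
    Prop where
  le : ∀ p ∈ R, p.1 ≤ K ∧ p.2 ≤ K
  left : ∀ s ≤ K, ∃ s', (s, s') ∈ R
  right : ∀ s ≤ K, ∃ s', (s', s) ∈ R
  conn : ∀ p ∈ R, ∀ q ∈ R, ReflTransGen (r R) p q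

/-- The path `0, 1, …, (k + 1) * (2 * l + 1) - 1` traverses a comb: over each `x ≤ k` it runs up a
tooth of height `l` and down again. `combFst l j` is the position `x` of the tooth. -/
def combFst (l j : ℕ) : ℕ := j / (2 * l + 1)

/-- The height, on its tooth, of the `j`-th point of the path traversing the comb. -/
def combSnd (l j : ℕ) : ℕ := min (j % (2 * l + 1)) (2 * l - j % (2 * l + 1))

/-- The point of the path traversing the comb at position `x` and height `y`, on the ascending
side if `σ = false` and on the descending side if `σ = true`. -/
def combPt (l x : ℕ) (σ : Bool) (y : ℕ) : ℕ := x * (2 * l + 1) + if σ then 2 * l - y else y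

theorem combFst_combPt {l x : ℕ} {σ : Bool} {y : ℕ} (hy : y ≤ l) :
    combFst l (combPt l x σ y) = x := by
  have h : (if σ then 2 * l - y else y) < 2 * l + 1 := by split_ifs <;> omega
  rw [combFst, combPt, add_comm, Nat.add_mul_div_right _ _ (by omega), Nat.div_eq_of_lt h, zero_add]

theorem combSnd_combPt {l x : ℕ} {σ : Bool} {y : ℕ} (hy : y ≤ l) :
    combSnd l (combPt l x σ y) = y := by
  have h : (if σ then 2 * l - y else y) < 2 * l + 1 := by split_ifs <;> omega
  rw [combSnd, combPt, add_comm, Nat.add_mul_mod_self_right, Nat.mod_eq_of_lt h]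
  split_ifs <;> omega

theorem combSnd_le (l j : ℕ) : combSnd l j ≤ l := by
  unfold combSnd
  omega

theorem exists_combPt_eq (l j : ℕ) : ∃ σ, combPt l (combFst l j) σ (combSnd l j) = j := by
  have h1 := Nat.div_add_mod j (2 * l + 1)
  have h2 := Nat.mod_lt j (show 0 < 2 * l + 1 by omega)
  rw [mul_comm] at h1
  rcases le_total (j % (2 * l + 1)) l with h | h
  · refine ⟨false, ?_⟩
    simp only [combPt, combFst, combSnd, Bool.false_eq_true, if_false]
    rw [min_eq_left (by omega), h1]
  · refine ⟨true, ?_⟩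
    simp only [combPt, combFst, combSnd, if_true]
    rw [min_eq_right (by omega), Nat.sub_sub_self (by omega), h1]

theorem combFst_le_iff {l k j : ℕ} : combFst l j ≤ k ↔ j ≤ (k + 1) * (2 * l + 1) - 1 := by
  have h : 0 < (k + 1) * (2 * l + 1) := by positivity
  rw [combFst, ← Nat.lt_succ_iff, Nat.div_lt_iff_lt_mul (by omega), Nat.succ_eq_add_one]
  omega

theorem combPt_top (l x : ℕ) (σ τ : Bool) : combPt l x σ l = combPt l x τ l := by
  cases σ <;> cases τ <;> simp [combPt] <;> omega

theorem combPt_succ (l x : ℕ) : combPt l (x + 1) false 0 = combPt l x true 0 + 1 := by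
  simp only [combPt, Bool.false_eq_true, if_false, if_true]
  ring_nf
  omega

theorem combPt_le_succ {l x : ℕ} {σ : Bool} {y z : ℕ} (hz : z ≤ l)
    (h1 : y ≤ z + 1) (h2 : z ≤ y + 1) : combPt l x σ y ≤ combPt l x σ z + 1 := by
  cases σ <;> simp [combPt] <;> omega

theorem combFst_succ (l j : ℕ) :
    combFst l (j + 1) ≤ combFst l j + 1 ∧ combFst l j ≤ combFst l (j + 1) + 1 := by
  have h1 : combFst l j ≤ combFst l (j + 1) := Nat.div_le_div_right (Nat.le_succ j)
  refine ⟨?_, by omega⟩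
  have : combFst l (j + 1) ≤ combFst l (j + (2 * l + 1)) := Nat.div_le_div_right (by omega)
  rwa [combFst, combFst, Nat.add_div_right _ (by omega)] at this

theorem combSnd_succ (l j : ℕ) :
    combSnd l (j + 1) ≤ combSnd l j + 1 ∧ combSnd l j ≤ combSnd l (j + 1) + 1 := by
  have h2 := Nat.mod_lt j (show 0 < 2 * l + 1 by omega)
  have h3 : (j + 1) % (2 * l + 1) = if j % (2 * l + 1) + 1 = 2 * l + 1 then 0
      else j % (2 * l + 1) + 1 := by
    rw [Nat.add_mod_eq_ite]
    rcases Nat.eq_zero_or_pos l with rfl | hl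
    · simp [Nat.mod_one]
    · rw [Nat.mod_eq_of_lt (show 1 < 2 * l + 1 by omega)]
      split_ifs <;> omega
  unfold combSnd
  rw [h3]
  split_ifs <;> omega

/-- The relation on the path traversing the comb which is compatible with `R` on positions and
with `S` on heights. -/
def combRel (l : ℕ) (R S : Set (ℕ × ℕ)) : Set (ℕ × ℕ) :=
  {p | (combFst l p.1, combFst l p.2) ∈ R ∧ (combSnd l p.1, combSnd l p.2) ∈ S}

/-- The combined relation is connected. With the positions fixed, the heights move freely in `S`,
and a side of a tooth is changed at its top. A rook step of `R` moves one point to the next tooth;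
this happens at height `0`, while the other point stays at a related height on its own tooth, so
nothing relates the two heights at which the two points change teeth. -/
theorem IsFullRel.combRel {k l : ℕ} {R S : Set (ℕ × ℕ)} (hR : IsFullRel RookStep k R)
    (hS : IsFullRel RookStep l S) :
    IsFullRel KingStep ((k + 1) * (2 * l + 1) - 1) (combRel l R S) := by
  set T := _root_.combRel l R S with hT
  have hmem : ∀ {x x' y y'} σ σ', (x, x') ∈ R → (y, y') ∈ S →
      (combPt l x σ y, combPt l x' σ' y') ∈ T := by
    intro x x' y y' σ σ' h h'
    obtain ⟨h1, h2⟩ := hS.le _ h'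
    refine ⟨?_, ?_⟩
    · simpa only [combFst_combPt h1, combFst_combPt h2] using h
    · simpa only [combSnd_combPt h1, combSnd_combPt h2] using h'
  have hfix : ∀ {x x'} σ σ', (x, x') ∈ R → ∀ p ∈ S, ∀ q ∈ S, ReflTransGen (KingStep T)
      (combPt l x σ p.1, combPt l x' σ' p.2) (combPt l x σ q.1, combPt l x' σ' q.2) := by
    intro x x' σ σ' h p hp q hq
    refine ReflTransGen.lift (fun p : ℕ × ℕ => (combPt l x σ p.1, combPt l x' σ' p.2)) ?_ _ _
      (hS.conn p hp q hq)
    rintro p q ⟨hp, hq, hpq⟩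
    obtain ⟨h1, h2⟩ := hS.le p hp
    obtain ⟨h3, h4⟩ := hS.le q hq
    exact ⟨hmem σ σ' h hp, hmem σ σ' h hq, combPt_le_succ h3 (by omega) (by omega),
      combPt_le_succ h1 (by omega) (by omega), combPt_le_succ h4 (by omega) (by omega),
      combPt_le_succ h2 (by omega) (by omega)⟩
  have hside : ∀ {x x'} σ σ' τ τ', (x, x') ∈ R → ∀ p ∈ S, ∀ q ∈ S, ReflTransGen (KingStep T)
      (combPt l x σ p.1, combPt l x' σ' p.2) (combPt l x τ q.1, combPt l x' τ' q.2) := by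
    intro x x' σ σ' τ τ' h p hp q hq
    obtain ⟨y', hy'⟩ := hS.left l le_rfl
    obtain ⟨y, hy⟩ := hS.right l le_rfl
    have h1 := hfix σ σ' h p hp _ hy'
    have h2 := hfix τ σ' h _ hy' _ hy
    have h3 := hfix τ τ' h _ hy q hq
    simp only at h1 h2 h3
    rw [combPt_top l x τ σ, combPt_top l x' σ' τ'] at h2
    exact (h1.trans h2).trans h3
  have hmove : ∀ {a b}, RookStep R a b → ∃ σ σ' τ τ', ∃ p ∈ S, ReflTransGen (KingStep T)
      (combPt l a.1 σ p.1, combPt l a.2 σ' p.2) (combPt l b.1 τ p.1, combPt l b.2 τ' p.2) := by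
    rintro ⟨x, x'⟩ ⟨z, z'⟩ ⟨ha, hb, h⟩
    obtain ⟨y', hy'⟩ := hS.left 0 (Nat.zero_le _)
    obtain ⟨y, hy⟩ := hS.right 0 (Nat.zero_le _)
    simp only at h
    rcases h with ⟨rfl, rfl | rfl⟩ | ⟨rfl, rfl | rfl⟩
    · refine ⟨true, true, false, true, _, hy', .single ⟨hmem _ _ ha hy', hmem _ _ hb hy', ?_⟩⟩
      simp only [combPt_succ]
      omega
    · refine ⟨false, true, true, true, _, hy', .single ⟨hmem _ _ ha hy', hmem _ _ hb hy', ?_⟩⟩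
      simp only [combPt_succ]
      omega
    · refine ⟨true, true, true, false, _, hy, .single ⟨hmem _ _ ha hy, hmem _ _ hb hy, ?_⟩⟩
      simp only [combPt_succ]
      omega
    · refine ⟨true, false, true, true, _, hy, .single ⟨hmem _ _ ha hy, hmem _ _ hb hy, ?_⟩⟩
      simp only [combPt_succ]
      omega
  have hall : ∀ a ∈ R, ∀ b, ReflTransGen (RookStep R) a b → ∀ σ σ' τ τ', ∀ p ∈ S, ∀ q ∈ S,
      ReflTransGen (KingStep T) (combPt l a.1 σ p.1, combPt l a.2 σ' p.2)
        (combPt l b.1 τ q.1, combPt l b.2 τ' q.2) := by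
    intro a ha b hab
    induction hab with
    | refl => exact fun σ σ' τ τ' => hside σ σ' τ τ' ha
    | tail hab hbc ih =>
      intro σ σ' τ τ' p hp q hq
      obtain ⟨ρ, ρ', υ, υ', r, hr, h⟩ := hmove hbc
      exact ((ih σ σ' ρ ρ' p hp r hr).trans h).trans (hside υ υ' τ τ' hbc.2.1 r hr q hq)
  refine ⟨fun p hp => ?_, fun j hj => ?_, fun j hj => ?_, ?_⟩
  · obtain ⟨h1, h2⟩ := hR.le _ hp.1
    exact ⟨combFst_le_iff.1 h1, combFst_le_iff.1 h2⟩
  · obtain ⟨x', hx'⟩ := hR.left _ (combFst_le_iff.2 hj)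
    obtain ⟨y', hy'⟩ := hS.left _ (combSnd_le l j)
    obtain ⟨σ, hσ⟩ := exists_combPt_eq l j
    have := hmem σ false hx' hy'
    rw [hσ] at this
    exact ⟨_, this⟩
  · obtain ⟨x', hx'⟩ := hR.right _ (combFst_le_iff.2 hj)
    obtain ⟨y', hy'⟩ := hS.right _ (combSnd_le l j)
    obtain ⟨σ, hσ⟩ := exists_combPt_eq l j
    have := hmem false σ hx' hy'
    rw [hσ] at this
    exact ⟨_, this⟩
  · rintro ⟨j, j'⟩ hj ⟨i, i'⟩ hi
    obtain ⟨σ, hσ⟩ := exists_combPt_eq l j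
    obtain ⟨σ', hσ'⟩ := exists_combPt_eq l j'
    obtain ⟨τ, hτ⟩ := exists_combPt_eq l i
    obtain ⟨τ', hτ'⟩ := exists_combPt_eq l i'
    have := hall _ hj.1 _ (hR.conn _ hj.1 _ hi.1) σ σ' τ τ' _ hj.2 _ hi.2
    simpa only [hσ, hσ', hτ, hτ'] using this

/-- A connected finite set is covered by a single walk. -/
theorem exists_walk_covering {V : Type*} {r : V → V → Prop} (s : Finset V) {p₀ : V}
    (h : ∀ p, p = p₀ ∨ p ∈ s → ∀ q ∈ s, ReflTransGen r p q) :
    ∃ (M : ℕ) (w : ℕ → V), w 0 = p₀ ∧ (∀ i < M, r (w i) (w (i + 1))) ∧ ∀ q ∈ s, ∃ i ≤ M, w i = q := by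
  classical
  let Cov : Finset V → V → Prop := fun s q => ∃ (M : ℕ) (w : ℕ → V), w 0 = p₀ ∧ w M = q ∧
    (∀ i < M, r (w i) (w (i + 1))) ∧ ∀ q ∈ s, ∃ i ≤ M, w i = q
  have hstep : ∀ s p q, ReflTransGen r p q → Cov s p → Cov s q := by
    intro s p q hpq
    induction hpq with
    | refl => exact id
    | tail _ hbc ih =>
      rename_i b c _
      intro hp
      obtain ⟨M, w, h0, hM, hw, hs⟩ := ih hp
      refine ⟨M + 1, Function.update w (M + 1) c, ?_, ?_, ?_, ?_⟩
      · rw [Function.update_of_ne (by omega), h0]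
      · rw [Function.update_self]
      · intro i hi
        rw [Function.update_of_ne (show i ≠ M + 1 by omega)]
        rcases Nat.lt_succ_iff_lt_or_eq.1 hi with hi | rfl
        · rw [Function.update_of_ne (by omega)]
          exact hw i hi
        · rw [Function.update_self, hM]
          exact hbc
      · intro q hq
        obtain ⟨i, hi, hiq⟩ := hs q hq
        exact ⟨i, by omega, by rw [Function.update_of_ne (by omega), hiq]⟩
  have hcov : ∀ t ⊆ s, ∃ q, (q = p₀ ∨ q ∈ s) ∧ Cov t q := by
    intro t
    induction t using Finset.induction_on with
    | empty => exact fun _ => ⟨p₀, .inl rfl, 0, fun _ => p₀, rfl, rfl, by simp, by simp⟩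
    | insert a t _ ih =>
      intro ht
      obtain ⟨q, hq, hqt⟩ := ih ((Finset.subset_insert a t).trans ht)
      have ha : a ∈ s := ht (Finset.mem_insert_self a t)
      obtain ⟨M, w, h0, hM, hw, hs⟩ := hstep t q a (h q hq a ha) hqt
      refine ⟨a, .inr ha, M, w, h0, hM, hw, fun b hb => ?_⟩
      rcases Finset.mem_insert.1 hb with rfl | hb
      · exact ⟨M, le_rfl, hM⟩
      · exact hs b hb
  obtain ⟨-, -, M, w, h0, -, hw, hs⟩ := hcov s subset_rfl
  exact ⟨M, w, h0, hw, hs⟩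

theorem IsFullRel.exists_walk {N : ℕ} {T : Set (ℕ × ℕ)} (hT : IsFullRel KingStep N T) :
    ∃ (M : ℕ) (w : ℕ → ℕ × ℕ), (∀ i ≤ M, w i ∈ T) ∧ (∀ i < M, KingStep T (w i) (w (i + 1))) ∧
      (∀ j ≤ N, ∃ i ≤ M, (w i).1 = j) ∧ ∀ j ≤ N, ∃ i ≤ M, (w i).2 = j := by
  have hfin : T.Finite := (finite_Iic ((N, N) : ℕ × ℕ)).subset fun p hp => hT.le p hp
  obtain ⟨s₀, hs₀⟩ := hT.left 0 (Nat.zero_le _)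
  obtain ⟨M, w, h0, hw, hs⟩ := exists_walk_covering (r := KingStep T) hfin.toFinset (p₀ := (0, s₀))
    (fun p hp q hq => hT.conn p (hp.elim (fun h => h ▸ hs₀) hfin.mem_toFinset.1) q
      (hfin.mem_toFinset.1 hq))
  refine ⟨M, w, ?_, hw, ?_, ?_⟩
  · rintro (_ | i) hi
    · rwa [h0]
    · exact (hw i hi).2.1
  · intro j hj
    obtain ⟨j', hj'⟩ := hT.left j hj
    obtain ⟨i, hi, h⟩ := hs _ (hfin.mem_toFinset.2 hj')
    exact ⟨i, hi, by rw [h]⟩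
  · intro j hj
    obtain ⟨j', hj'⟩ := hT.right j hj
    obtain ⟨i, hi, h⟩ := hs _ (hfin.mem_toFinset.2 hj')
    exact ⟨i, hi, by rw [h]⟩

/-! ### The relation of a homeomorphism at a finite scale -/

/-- The trace of the map `h` on the integer points of the arc `[0, K]`, as seen through `a`. -/
def coarseRel {X : Type*} (a : X → ℝ) (h : X → X) (K : ℕ) : Set (ℕ × ℕ) :=
  {p | p.1 ≤ K ∧ p.2 ≤ K ∧ ∃ x, |a x - p.1| ≤ 1 ∧ |a (h x) - p.2| ≤ 1}

instance (R : Set (ℕ × ℕ)) : Std.Symm (RookStep R) :=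
  ⟨fun _ _ ⟨h1, h2, h3⟩ => ⟨h2, h1, by omega⟩⟩

/-- The integer pairs near `(a x, a (h x))` form a box, which is connected by rook steps, and the
boxes of nearby points share a pair; so connectedness of the space gives that of the relation. -/
theorem isFullRel_coarseRel {X : Type*} [TopologicalSpace X] [ConnectedSpace X] {a : X → ℝ}
    {K : ℕ} (ha : IsArcMap a K) (h : X ≃ₜ X) : IsFullRel RookStep K (coarseRel a h K) := by
  set R := coarseRel a h K with hR
  have hgrid : ∀ s ≤ K, ∃ x, a x = s := fun s hs =>
    ha.exists_eq s.cast_nonneg (by exact_mod_cast hs)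
  let B : X → Set (ℕ × ℕ) := fun x =>
    {p | p.1 ≤ K ∧ p.2 ≤ K ∧ |a x - p.1| ≤ 1 ∧ |a (h x) - p.2| ≤ 1}
  have hBR : ∀ {x p}, p ∈ B x → p ∈ R := fun {x p} hp => ⟨hp.1, hp.2.1, x, hp.2.2⟩
  have hsymm : ∀ {p q}, ReflTransGen (RookStep R) p q → ReflTransGen (RookStep R) q p :=
    fun {p q} hpq => Std.Symm.symm _ _ hpq
  have hbetween : ∀ {c : ℝ} {s t u : ℕ}, |c - s| ≤ 1 → |c - u| ≤ 1 → s ≤ t → t ≤ u →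
      |c - t| ≤ 1 := by
    intro c s t u h1 h2 h3 h4
    have h3' : (s : ℝ) ≤ t := by exact_mod_cast h3
    have h4' : (t : ℝ) ≤ u := by exact_mod_cast h4
    rw [abs_le] at *
    constructor <;> linarith
  -- All points of the box `B x` are connected by rook steps.
  have hrow : ∀ {x s u m}, s ≤ u → (s, m) ∈ B x → (u, m) ∈ B x →
      ReflTransGen (RookStep R) (s, m) (u, m) := by
    rintro x s u m hsu ⟨h1, h2, h3, h4⟩ ⟨h1', -, h3', -⟩
    have key : ∀ t, s ≤ t → t ≤ u → ReflTransGen (RookStep R) (s, m) (t, m) := by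
      intro t hst
      induction t, hst using Nat.le_induction with
      | base => exact fun _ => .refl
      | succ t hst ih =>
        intro htu
        exact (ih (by omega)).tail ⟨⟨by simp only at *; omega, h2, x,
          hbetween h3 h3' hst (by omega), h4⟩, ⟨by simp only at *; omega, h2, x,
          hbetween h3 h3' (by omega) htu, h4⟩, .inl ⟨rfl, .inl rfl⟩⟩
    exact key u hsu le_rfl
  have hcol : ∀ {x s u m}, s ≤ u → (m, s) ∈ B x → (m, u) ∈ B x →
      ReflTransGen (RookStep R) (m, s) (m, u) := by
    rintro x s u m hsu ⟨h1, h2, h3, h4⟩ ⟨-, h2', -, h4'⟩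
    have key : ∀ t, s ≤ t → t ≤ u → ReflTransGen (RookStep R) (m, s) (m, t) := by
      intro t hst
      induction t, hst using Nat.le_induction with
      | base => exact fun _ => .refl
      | succ t hst ih =>
        intro htu
        exact (ih (by omega)).tail ⟨⟨h1, by simp only at *; omega, x, h3,
          hbetween h4 h4' hst (by omega)⟩, ⟨h1, by simp only at *; omega, x, h3,
          hbetween h4 h4' (by omega) htu⟩, .inr ⟨rfl, .inl rfl⟩⟩
    exact key u hsu le_rfl
  have hbox : ∀ {x p q}, p ∈ B x → q ∈ B x → ReflTransGen (RookStep R) p q := by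
    rintro x ⟨p, p'⟩ ⟨q, q'⟩ hp hq
    have hm : (q, p') ∈ B x := ⟨hq.1, hp.2.1, hq.2.2.1, hp.2.2.2⟩
    have h1 : ReflTransGen (RookStep R) (p, p') (q, p') :=
      (le_total p q).elim (fun h => hrow h hp hm) fun h => hsymm (hrow h hm hp)
    have h2 : ReflTransGen (RookStep R) (q, p') (q, q') :=
      (le_total p' q').elim (fun h => hcol h hm hq) fun h => hsymm (hcol h hq hm)
    exact h1.trans h2
  have hround : ∀ x, ∃ p : ℕ × ℕ, p.1 ≤ K ∧ p.2 ≤ K ∧ |a x - p.1| ≤ 1 / 2 ∧ |a (h x) - p.2| ≤ 1 / 2 := by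
    intro x
    obtain ⟨s, hs, hxs⟩ := ha.exists_nat x
    obtain ⟨t, ht, hxt⟩ := ha.exists_nat (h x)
    exact ⟨(s, t), hs, ht, hxs, hxt⟩
  have hB : ∀ x, (B x).Nonempty := fun x => by
    obtain ⟨p, h1, h2, h3, h4⟩ := hround x
    exact ⟨p, h1, h2, by linarith, by linarith⟩
  let Q : X → X → Prop := fun x y => ∀ p ∈ B x, ∀ q ∈ B y, ReflTransGen (RookStep R) p q
  have : Std.Symm Q := ⟨fun x y hxy p hp q hq => hsymm (hxy q hq p hp)⟩
  have hQ : ∀ x y, Q x y := by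
    refine PreconnectedSpace.induction₂ Q (fun x => ?_)
      ⟨fun x y z hxy hyz p hp q hq => ?_⟩
    · obtain ⟨r, h1, h2, h3, h4⟩ := hround x
      have c1 : ∀ᶠ y in 𝓝 x, |a y - a x| < 1 / 2 :=
        ha.continuous.continuousAt.eventually (Metric.ball_mem_nhds (a x) one_half_pos)
      have c2 : ∀ᶠ y in 𝓝 x, |a (h y) - a (h x)| < 1 / 2 :=
        (ha.continuous.comp h.continuous).continuousAt.eventually
          (Metric.ball_mem_nhds (a (h x)) one_half_pos)
      filter_upwards [c1, c2] with y hy1 hy2 p hp q hq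
      have hx : r ∈ B x := ⟨h1, h2, by linarith, by linarith⟩
      have hy : r ∈ B y := by
        refine ⟨h1, h2, ?_, ?_⟩
        · rw [abs_le] at h3 ⊢
          rw [abs_lt] at hy1
          constructor <;> linarith
        · rw [abs_le] at h4 ⊢
          rw [abs_lt] at hy2
          constructor <;> linarith
      exact (hbox hp hx).trans (hbox hy hq)
    · obtain ⟨r, hr⟩ := hB y
      exact (hxy p hp r hr).trans (hyz r hr q hq)
  refine ⟨fun p hp => ⟨hp.1, hp.2.1⟩, fun s hs => ?_, fun s hs => ?_, ?_⟩
  · obtain ⟨x, hx⟩ := hgrid s hs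
    obtain ⟨t, ht, hxt⟩ := ha.exists_nat (h x)
    exact ⟨t, hs, ht, x, by simp [hx], by linarith⟩
  · obtain ⟨y, hy⟩ := hgrid s hs
    obtain ⟨t, ht, hxt⟩ := ha.exists_nat (h.symm y)
    exact ⟨t, ht, hs, h.symm y, by linarith, by simp [hy]⟩
  · rintro p ⟨hp1, hp2, x, hx⟩ q ⟨hq1, hq2, y, hy⟩
    exact hQ x y p ⟨hp1, hp2, hx⟩ q ⟨hq1, hq2, hy⟩

/-! ### Joint approximation of two families of homeomorphisms -/

theorem HereditarilyIndecomposable.exists_isArcMap_lift_nat {X : Type*} [TopologicalSpace X]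
    [CompactSpace X] [T2Space X] [ConnectedSpace X] (hX : HereditarilyIndecomposable X)
    {K N : ℕ} (hK : 1 ≤ K) {f : X → ℝ} (hf : IsArcMap f K) {γ : ℕ → ℕ}
    (hγ : ∀ j < N, γ (j + 1) ≤ γ j + 1 ∧ γ j ≤ γ (j + 1) + 1) (hγK : ∀ j ≤ N, γ j ≤ K)
    (hγs : ∀ s ≤ K, ∃ j ≤ N, γ j = s) :
    ∃ F : X → ℝ, IsArcMap F N ∧ ∀ x, ∀ j ≤ N, |F x - j| < 1 → |f x - γ j| ≤ 3 := by
  obtain ⟨a, ha, ha0⟩ := hγs 0 (Nat.zero_le _)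
  obtain ⟨b, hb, hbK⟩ := hγs K le_rfl
  have hK' : (1 : ℝ) ≤ K := by exact_mod_cast hK
  obtain ⟨F, hF, hFγ⟩ := hX.exists_isArcMap_lift hf.continuous (M := N) (v := fun j => (γ j : ℝ))
    (δ := 1)
    (fun j hj => by
      obtain ⟨h1, h2⟩ := hγ j hj
      have h1' : (γ (j + 1) : ℝ) ≤ γ j + 1 := by exact_mod_cast h1
      have h2' : (γ j : ℝ) ≤ γ (j + 1) + 1 := by exact_mod_cast h2
      exact abs_le.2 ⟨by linarith, by linarith⟩) ha hb
    (fun j hj => by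
      simp only [ha0, hbK, Nat.cast_zero]
      exact ⟨Nat.cast_nonneg _, by exact_mod_cast hγK j hj⟩)
    (by
      simp only [ha0, hbK, Nat.cast_zero]
      linarith)
    (by
      obtain ⟨x, hx⟩ := hf.exists_eq le_rfl (by linarith)
      exact ⟨x, by simp [ha0, hx]⟩)
    (by
      obtain ⟨x, hx⟩ := hf.exists_eq (t := K) (by linarith) le_rfl
      exact ⟨x, by simp [hbK, hx]⟩)
    (fun x => by
      obtain ⟨h1, h2⟩ := hf.mem_Icc x
      simp only [ha0, hbK, Nat.cast_zero]
      constructor <;> linarith)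
  exact ⟨F, hF, fun x j hj h => (hFγ x j hj h).trans (by norm_num)⟩

theorem abs_sub_le_of_nat_lipschitz {γ : ℕ → ℕ}
    (hγ : ∀ j, γ (j + 1) ≤ γ j + 1 ∧ γ j ≤ γ (j + 1) + 1) (i j : ℕ) :
    |(γ i : ℝ) - γ j| ≤ |(i : ℝ) - j| := by
  have key : ∀ i n, |(γ (i + n) : ℝ) - γ i| ≤ n := by
    intro i n
    induction n with
    | zero => simp
    | succ n ih =>
      obtain ⟨h1, h2⟩ := hγ (i + n)
      have h1' : (γ (i + (n + 1)) : ℝ) ≤ γ (i + n) + 1 := by exact_mod_cast h1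
      have h2' : (γ (i + n) : ℝ) ≤ γ (i + (n + 1)) + 1 := by exact_mod_cast h2
      push_cast
      rw [abs_le] at ih ⊢
      constructor <;> linarith
  rcases le_total i j with h | h
  · obtain ⟨n, rfl⟩ := Nat.exists_eq_add_of_le h
    rw [abs_sub_comm]
    refine (key i n).trans (le_of_eq ?_)
    push_cast
    rw [show (i : ℝ) - (i + n) = -n by ring, abs_neg, Nat.abs_cast]
  · obtain ⟨n, rfl⟩ := Nat.exists_eq_add_of_le h
    refine (key j n).trans (le_of_eq ?_)
    push_cast
    rw [add_sub_cancel_left, Nat.abs_cast]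

section Pseudoarc

variable {P : Type*} [MetricSpace P]

/-- Every connected full relation `T` on a finite arc is realized approximately by a
homeomorphism: both coordinates of a walk covering `T` are lifted, and the lifts are matched. -/
theorem IsPseudoarc.exists_homeomorph_of_isFullRel (hP : IsPseudoarc P) {N : ℕ} (hN : 1 ≤ N)
    {p : P → ℝ} (hp : IsArcMap p N) {T : Set (ℕ × ℕ)} (hT : IsFullRel KingStep N T) :
    ∃ F : P ≃ₜ P, ∀ x, ∃ q ∈ T, |p x - q.1| ≤ 3 ∧ |p (F x) - q.2| ≤ 3 := by
  have := hP.compact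
  have := hP.connected
  have := hP.nontrivial
  obtain ⟨M, w, hwT, hw, hs, hs'⟩ := hT.exists_walk
  obtain ⟨f, hf, hfp⟩ := hP.hereditarilyIndecomposable.exists_isArcMap_lift_nat hN hp
    (γ := fun i => (w i).1) (fun i hi => ⟨(hw i hi).2.2.2.1, (hw i hi).2.2.1⟩)
    (fun i hi => (hT.le _ (hwT i hi)).1) hs
  obtain ⟨g, hg, hgp⟩ := hP.hereditarilyIndecomposable.exists_isArcMap_lift_nat hN hp
    (γ := fun i => (w i).2) (fun i hi => ⟨(hw i hi).2.2.2.2.2, (hw i hi).2.2.2.2.1⟩)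
    (fun i hi => (hT.le _ (hwT i hi)).2) hs'
  have hM : 1 ≤ M := by
    obtain ⟨i, hi, hi0⟩ := hs 0 (Nat.zero_le _)
    obtain ⟨j, hj, hj1⟩ := hs 1 hN
    by_contra! h
    obtain rfl : i = j := by omega
    omega
  obtain ⟨F, hF⟩ := exists_homeomorph_matching hP.hereditarilyIndecomposable hP.chainable
    hP.hereditarilyIndecomposable hP.chainable hM hf hg
  refine ⟨F, fun x => ?_⟩
  obtain ⟨i, hi, hxi⟩ := hf.exists_nat x
  refine ⟨w i, hwT i hi, hfp x i hi (by linarith), hgp (F x) i hi ?_⟩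
  have h1 := abs_le.1 (hF x)
  have h2 := abs_le.1 hxi
  exact abs_lt.2 ⟨by linarith, by linarith⟩

/-- The map `a ∘ θ` approximates `γ ∘ p` for a suitable homeomorphism `θ`. -/
theorem IsPseudoarc.exists_homeomorph_comp_near (hP : IsPseudoarc P) {N K : ℕ} (hK : 1 ≤ K)
    {p a : P → ℝ} (hp : IsArcMap p N) (ha : IsArcMap a K) {γ : ℕ → ℕ}
    (hγ : ∀ j, γ (j + 1) ≤ γ j + 1 ∧ γ j ≤ γ (j + 1) + 1) (hγK : ∀ j ≤ N, γ j ≤ K)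
    (hγs : ∀ s ≤ K, ∃ j ≤ N, γ j = s) :
    ∃ θ : P ≃ₜ P, ∀ x (j : ℕ), |p x - j| ≤ 3 → |a (θ x) - γ j| ≤ 7 := by
  have := hP.compact
  have := hP.connected
  have := hP.nontrivial
  obtain ⟨f, hf, hfa⟩ := hP.hereditarilyIndecomposable.exists_isArcMap_lift_nat hK ha
    (fun j _ => hγ j) hγK hγs
  have hN : 1 ≤ N := by
    obtain ⟨i, hi, hi0⟩ := hγs 0 (Nat.zero_le _)
    obtain ⟨j, hj, hj1⟩ := hγs 1 hK
    by_contra! h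
    obtain rfl : i = j := by omega
    omega
  obtain ⟨θ, hθ⟩ := exists_homeomorph_matching hP.hereditarilyIndecomposable hP.chainable
    hP.hereditarilyIndecomposable hP.chainable hN hp hf
  refine ⟨θ, fun x j hj => ?_⟩
  obtain ⟨i, hi, hxi⟩ := hp.exists_nat x
  have h1 := abs_le.1 (hθ x)
  have h2 := abs_le.1 hxi
  have h3 := abs_le.1 hj
  have h4 := abs_le.1 (hfa (θ x) i hi (abs_lt.2 ⟨by linarith, by linarith⟩))
  have h5 := abs_le.1 ((abs_sub_le_of_nat_lipschitz hγ i j).trans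
    (show |(i : ℝ) - j| ≤ 7 / 2 from abs_le.2 ⟨by linarith, by linarith⟩))
  exact abs_le.2 ⟨by linarith, by linarith⟩

/-- If `a` is fine enough, a map is determined up to `ε` by its trace through `a`. -/
theorem IsPseudoarc.exists_fine_isArcMap (hP : IsPseudoarc P) {ι : Type*} [Finite ι]
    (h : ι → P ≃ₜ P) {ε : ℝ} (hε : 0 < ε) : ∃ (K : ℕ) (a : P → ℝ), 1 ≤ K ∧ IsArcMap a K ∧
      ∀ i (f : P → P), (∀ x, ∃ q ∈ coarseRel a (h i) K, |a x - q.1| ≤ 7 ∧ |a (f x) - q.2| ≤ 7) →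
        ∀ x, dist (f x) (h i x) < ε := by
  have := hP.compact
  have := hP.connected
  have := hP.nontrivial
  have hθ : ∀ᶠ θ in 𝓝[>] (0 : ℝ), ∀ i, ∀ x y, dist x y < θ → dist (h i x) (h i y) < ε / 2 := by
    refine Filter.eventually_all.2 fun i => ?_
    obtain ⟨θ, hθ, hi⟩ := Metric.uniformContinuous_iff.1
      (CompactSpace.uniformContinuous_of_continuous (h i).continuous) (ε / 2) (half_pos hε)
    filter_upwards [Ioc_mem_nhdsGT hθ] with θ' hθ' x y hxy
    exact hi (hxy.trans_le hθ'.2)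
  obtain ⟨θ, hθ, hθ0⟩ := (hθ.and self_mem_nhdsWithin).exists
  obtain ⟨K, a, hK, ha, hfine⟩ := hP.chainable.exists_isArcMap
    (lt_min (half_pos hε) (show 0 < θ from hθ0)) (show (0 : ℝ) < 8 by norm_num)
  refine ⟨K, a, hK, ha, fun i f hf x => ?_⟩
  obtain ⟨q, ⟨-, -, y, hy1, hy2⟩, hq1, hq2⟩ := hf x
  rw [abs_le] at hy1 hy2 hq1 hq2
  have d1 := hfine x y (abs_le.2 ⟨by linarith, by linarith⟩)
  have d2 := hfine (f x) (h i y) (abs_le.2 ⟨by linarith, by linarith⟩)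
  have d3 := hθ i y x (by rw [dist_comm]; exact d1.trans_le (min_le_right _ _))
  have d4 := d2.trans_le (min_le_left _ _)
  have := dist_triangle (f x) (h i y) (h i x)
  linarith

/-- **Joint approximation.** Two finite families of homeomorphisms of the pseudoarc are both
approximated by conjugates of one family. -/
theorem IsPseudoarc.exists_joint_approximation (hP : IsPseudoarc P) {ι : Type*} [Finite ι]
    (h k : ι → P ≃ₜ P) {ε : ℝ} (hε : 0 < ε) : ∃ (F : ι → P ≃ₜ P) (θ θ' : P ≃ₜ P),
      (∀ i x, dist (θ (F i (θ.symm x))) (h i x) < ε) ∧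
      ∀ i x, dist (θ' (F i (θ'.symm x))) (k i x) < ε := by
  have := hP.compact
  have := hP.connected
  have := hP.nontrivial
  obtain ⟨K, a, hK, ha, hfa⟩ := hP.exists_fine_isArcMap h hε
  obtain ⟨L, b, hL, hb, hfb⟩ := hP.exists_fine_isArcMap k hε
  set N := (K + 1) * (2 * L + 1) - 1 with hN
  have hT : ∀ i, IsFullRel KingStep N (combRel L (coarseRel a (h i) K) (coarseRel b (k i) L)) :=
    fun i => (isFullRel_coarseRel ha (h i)).combRel (isFullRel_coarseRel hb (k i))
  have hFs : ∀ s ≤ K, ∃ j ≤ N, combFst L j = s := fun s hs => by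
    have := combFst_combPt (l := L) (x := s) (σ := false) (Nat.zero_le L)
    exact ⟨_, combFst_le_iff.1 (this.trans_le hs), this⟩
  have hSs : ∀ s ≤ L, ∃ j ≤ N, combSnd L j = s := fun s hs =>
    ⟨combPt L 0 false s, combFst_le_iff.1 ((combFst_combPt hs).trans_le (Nat.zero_le _)),
      combSnd_combPt hs⟩
  have hN1 : 1 ≤ N := by
    obtain ⟨i, hi, hi0⟩ := hFs 0 (Nat.zero_le _)
    obtain ⟨j, hj, hj1⟩ := hFs 1 hK
    by_contra! h
    obtain rfl : i = j := by omega
    omega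
  -- Any map onto `[0, N]` will do; it is obtained by lifting `a`.
  obtain ⟨p, hp, -⟩ := hP.hereditarilyIndecomposable.exists_isArcMap_lift_nat hK ha
    (fun j _ => combFst_succ L j) (fun j hj => combFst_le_iff.2 hj) hFs
  choose F hF using fun i => hP.exists_homeomorph_of_isFullRel hN1 hp (hT i)
  obtain ⟨θ, hθ⟩ := hP.exists_homeomorph_comp_near hK hp ha (combFst_succ L)
    (fun j hj => combFst_le_iff.2 hj) hFs
  obtain ⟨θ', hθ'⟩ := hP.exists_homeomorph_comp_near hL hp hb (combSnd_succ L)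
    (fun j _ => combSnd_le L j) hSs
  refine ⟨F, θ, θ', fun i => hfa i (fun x => θ (F i (θ.symm x))) fun x => ?_,
    fun i => hfb i (fun x => θ' (F i (θ'.symm x))) fun x => ?_⟩
  · obtain ⟨q, hq, h1, h2⟩ := hF i (θ.symm x)
    refine ⟨_, hq.1, ?_, hθ _ _ h2⟩
    simpa using hθ _ _ h1
  · obtain ⟨q, hq, h1, h2⟩ := hF i (θ'.symm x)
    refine ⟨_, hq.2, ?_, hθ' _ _ h2⟩
    simpa using hθ' _ _ h1

end Pseudoarc

/-! ### Baire category in the homeomorphism group -/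

theorem continuous_homeomorph_conj {P : Type*} [MetricSpace P] (g : P ≃ₜ P) : Continuous fun f : P ≃ₜ P => g * f * g⁻¹ := by
  refine continuous_induced_rng.2 ?_
  let u : C(P, P) := ⟨g, g.continuous⟩
  let v : C(P, P) := ⟨g.symm, g.symm.continuous⟩
  have h : Continuous fun f : C(P, P) => (u.comp f).comp v :=
    (ContinuousMap.continuous_precomp v).comp (ContinuousMap.continuous_postcomp u)
  have h' : Continuous fun f : P ≃ₜ P => (⟨f, f.continuous⟩ : C(P, P)) := continuous_induced_dom
  exact h.comp h'

section HomeoTopology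

variable {P : Type*} [MetricSpace P] [CompactSpace P]

theorem Homeomorph.mem_nhds_iff_dist {h : P ≃ₜ P} {s : Set (P ≃ₜ P)} :
    s ∈ 𝓝 h ↔ ∃ ε > 0, ∀ f : P ≃ₜ P, (∀ x, dist (f x) (h x) < ε) → f ∈ s := by
  rw [nhds_induced, Filter.mem_comap]
  constructor
  · rintro ⟨t, ht, hts⟩
    obtain ⟨ε, hε, hεt⟩ := Metric.mem_nhds_iff.1 ht
    exact ⟨ε, hε, fun f hf => hts (hεt ((ContinuousMap.dist_lt_iff hε).2 hf))⟩
  · rintro ⟨ε, hε, hs⟩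
    exact ⟨_, Metric.ball_mem_nhds _ hε, fun f hf => hs f ((ContinuousMap.dist_lt_iff hε).1 hf)⟩

theorem continuous_homeomorph_symm : Continuous (Homeomorph.symm : (P ≃ₜ P) → (P ≃ₜ P)) := by
  rw [continuous_iff_continuousAt]
  intro f s hs
  obtain ⟨ε, hε, hεs⟩ := Homeomorph.mem_nhds_iff_dist.1 hs
  obtain ⟨δ, hδ, hf⟩ := Metric.uniformContinuous_iff.1
    (CompactSpace.uniformContinuous_of_continuous f.symm.continuous) ε hε
  refine Filter.mem_map.2 (Homeomorph.mem_nhds_iff_dist.2 ⟨δ, hδ, fun g hg => hεs _ fun y => ?_⟩)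
  have := hf (hg (g.symm y))
  rwa [g.apply_symm_apply, f.symm_apply_apply, dist_comm] at this

/-- The homeomorphism group is Polish: it is identified with the closed set of pairs of mutually
inverse maps. -/
instance : PolishSpace (P ≃ₜ P) := by
  let ι : (P ≃ₜ P) → C(P, P) := fun f => ⟨f, f.continuous⟩
  have hι : Continuous ι := continuous_induced_dom
  let e : (P ≃ₜ P) → C(P, P) × C(P, P) := fun f => (ι f, ι f.symm)
  have he : Continuous e := hι.prodMk (hι.comp continuous_homeomorph_symm)
  have hind : Topology.IsInducing e :=
    .of_comp he continuous_fst ⟨rfl⟩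
  refine Topology.IsClosedEmbedding.polishSpace (f := e) ⟨⟨hind, ?_⟩, ?_⟩
  · intro f g hfg
    ext x
    exact DFunLike.congr_fun (congr_arg Prod.fst hfg) x
  · have : range e = {p | p.1.comp p.2 = .id P ∧ p.2.comp p.1 = .id P} := by
      ext ⟨u, v⟩
      constructor
      · rintro ⟨f, hf⟩
        obtain ⟨rfl, rfl⟩ := Prod.ext_iff.1 hf
        exact ⟨ContinuousMap.ext f.apply_symm_apply, ContinuousMap.ext f.symm_apply_apply⟩
      · rintro ⟨h1, h2⟩
        exact ⟨⟨⟨u, v, DFunLike.congr_fun h2, DFunLike.congr_fun h1⟩, u.continuous, v.continuous⟩,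
          rfl⟩
    rw [this]
    refine IsClosed.inter (isClosed_eq ?_ continuous_const) (isClosed_eq ?_ continuous_const)
    · exact ContinuousMap.continuous_comp'.comp (continuous_snd.prodMk continuous_fst)
    · exact ContinuousMap.continuous_comp'.comp (continuous_fst.prodMk continuous_snd)

theorem exists_finite_approx_subset {ι : Type*} {U : Set (ι → (P ≃ₜ P))} (hU : IsOpen U)
    {h : ι → (P ≃ₜ P)} (hh : h ∈ U) : ∃ (s : Finset ι) (ε : ℝ), 0 < ε ∧
      ∀ f : ι → (P ≃ₜ P), (∀ i ∈ s, ∀ x, dist (f i x) (h i x) < ε) → f ∈ U := by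
  obtain ⟨s, u, hu, hsU⟩ := isOpen_pi_iff.1 hU h hh
  have : ∀ᶠ ε in 𝓝[>] (0 : ℝ), ∀ i ∈ s, ∀ f : P ≃ₜ P, (∀ x, dist (f x) (h i x) < ε) → f ∈ u i := by
    refine (Filter.eventually_all_finset s).2 fun i hi => ?_
    obtain ⟨ε, hε, hi⟩ := Homeomorph.mem_nhds_iff_dist.1 ((hu i hi).1.mem_nhds (hu i hi).2)
    filter_upwards [Ioc_mem_nhdsGT hε] with ε' hε' f hf
    exact hi f fun x => (hf x).trans_le hε'.2
  obtain ⟨ε, hε, hε0⟩ := (this.and self_mem_nhdsWithin).exists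
  exact ⟨s, ε, hε0, fun f hf => hsU fun i hi => hε i hi (f i) (hf i hi)⟩

end HomeoTopology

/-- Joint approximation says that the diagonal conjugacy action is topologically transitive; the
Baire category theorem yields a point with dense orbit. -/
theorem IsPseudoarc.exists_dense_diagonalConjOrbit {P : Type*} [MetricSpace P]
    (hP : IsPseudoarc P) (ι : Type*) [Countable ι] :
    ∃ γ : ι → (P ≃ₜ P), Dense (diagonalConjOrbit γ) := by
  have := hP.compact
  let act : (P ≃ₜ P) → (ι → (P ≃ₜ P)) → (ι → (P ≃ₜ P)) := fun g γ i => g * γ i * g⁻¹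
  have hact : ∀ g, Continuous (act g) := fun g =>
    continuous_pi fun i => (continuous_homeomorph_conj g).comp (continuous_apply i)
  have htrans : ∀ U V : Set (ι → (P ≃ₜ P)), IsOpen U → IsOpen V → U.Nonempty → V.Nonempty →
      ∃ γ ∈ U, ∃ g, act g γ ∈ V := by
    rintro U V hU hV ⟨h, hh⟩ ⟨k, hk⟩
    obtain ⟨s, ε, hε, hsU⟩ := exists_finite_approx_subset hU hh
    obtain ⟨t, ε', hε', htV⟩ := exists_finite_approx_subset hV hk
    classical
    obtain ⟨F, θ, θ', hF, hF'⟩ := hP.exists_joint_approximation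
      (fun i : (s ∪ t : Finset ι) => h i) (fun i => k i) (lt_min hε hε')
    let f : ι → (P ≃ₜ P) := fun i => if hi : i ∈ s ∪ t then F ⟨i, hi⟩ else 1
    have hf : ∀ i (hi : i ∈ s ∪ t), f i = F ⟨i, hi⟩ := fun i hi => dif_pos hi
    refine ⟨act θ f, hsU _ fun i hi x => ?_, θ' * θ⁻¹, htV _ fun i hi x => ?_⟩
    · have hi' := Finset.mem_union_left t hi
      have := (hF ⟨i, hi'⟩ x).trans_le (min_le_left _ _)
      rw [← hf i hi'] at this
      exact this
    · have hi' := Finset.mem_union_right s hi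
      have := (hF' ⟨i, hi'⟩ x).trans_le (min_le_right _ _)
      rw [← hf i hi'] at this
      have e : act (θ' * θ⁻¹) (act θ f) i = θ' * f i * θ'⁻¹ := by
        simp only [act]
        group
      rw [e]
      exact this
  let S := TopologicalSpace.countableBasis (ι → (P ≃ₜ P))
  have hS := TopologicalSpace.isBasis_countableBasis (ι → (P ≃ₜ P))
  have hdense : Dense (⋂ V ∈ S, ⋃ g, act g ⁻¹' V) := by
    refine dense_biInter_of_isOpen (fun V hV => isOpen_iUnion fun g => (hS.isOpen hV).preimage (hact g))
      (TopologicalSpace.countable_countableBasis _) fun V hV => ?_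
    refine dense_iff_inter_open.2 fun U hU hUne => ?_
    obtain ⟨γ, hγ, g, hg⟩ := htrans U V hU (hS.isOpen hV) hUne
      (TopologicalSpace.nonempty_of_mem_countableBasis hV)
    exact ⟨γ, hγ, mem_iUnion.2 ⟨g, hg⟩⟩
  obtain ⟨γ, hγ⟩ := hdense.nonempty
  refine ⟨γ, dense_iff_inter_open.2 fun U hU ⟨δ, hδ⟩ => ?_⟩
  obtain ⟨V, hV, -, hVU⟩ := hS.exists_subset_of_mem_open hδ hU
  obtain ⟨g, hg⟩ := mem_iUnion.1 (mem_iInter₂.1 hγ V hV)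
  exact ⟨act g γ, hVU hg, (mem_diagonalConjOrbit_iff γ _).2 ⟨g, rfl⟩⟩

theorem theorem1p1 (P : Type*) [MetricSpace P] (hP : IsPseudoarc P) :
    (∀ n : ℕ, 1 ≤ n → ∃ γ : Fin n → (P ≃ₜ P), Dense (diagonalConjOrbit γ)) ∧
      ∃ γ : ℕ → (P ≃ₜ P), Dense (diagonalConjOrbit γ) :=
  ⟨fun n _ => hP.exists_dense_diagonalConjOrbit (Fin n), hP.exists_dense_diagonalConjOrbit ℕ⟩
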